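/- **Setting.** Let $d\ge 1$, $I_\pm=\{\pm1,\dots,\pm d\}$, let $r:I_\pm\to\mathbb Z^d$ be a jump function, $\bar r=\frac1{2d}\sum_{\tau}r(\tau)$, let $C(\omega)$ be a random unitary matrix on $\mathbb C^{2d}$ (with canonical basis $|\tau\rangle$, $\tau\in I_\pm$) defined on a probability space $(\Omega,\mu)$, and let $\varphi_0\in\mathbb C^{2d}$ be a unit vector. For $\bar\omega=(\omega_1,\omega_2,\dots)$ i.i.d. with law $\mu$, the quantum walk on $\mathbb C^{2d}\otimes\ell^2(\mathbb Z^d)$ is $\psi_n=U_n\cdots U_1(\varphi_0\otimes|0\rangle)$ with $U_k=S(C(\omega_k)\otimes\mathbb I)$ and $S(|\tau\rangle\otimes|x\rangle)=|\tau\rangle\otimes|x+r(\tau)\rangle$. Let $X_n$ be a random variable in $\mathbb Z^d$ with the averaged law $w_k(n)=\mathbb E\,\|\psi_n(k)\|^2$. Let $\mathcal E=\mathbb E\,(C(\omega)\otimes\overline{C(\omega)})$, $D(y,y')=\sum_{\tau,\tau'}e^{i(y\cdot r(\tau)+y'\cdot r(\tau'))}|\tau\otimes\tau'\rangle\langle\tau\otimes\tau'|$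 and $\mathcal M(y,y')=D(y,y')\mathcal E$. *Assumption S*: for all $v\in\mathbb T^d=[0,2\pi)^d$, the only eigenvalue of $\mathcal M(-v,v)$ on the unit circle is $1$, and it is simple. Let $P$ be the orthogonal projector onto $\mathbb C\sum_\tau|\tau\otimes\tau\rangle$ and let $S_v(1)$ be the value at $z=1$ of $S_v(z)=(\mathcal M(-v,v)-z)^{-1}-\frac{P}{1-z}$ (the reduced resolvent). The diffusion matrix $\mathbb D(v)$ of the centred walk is the real symmetric $d\times d$ matrix with, writing $\rho(\tau)=r(\tau)-\bar r$, $$\langle y,\mathbb D(v)y\rangle=-\frac1{2d}\sum_\tau (y\cdot\rho(\tau))^2-\frac1d\sum_{\tau,\tau'}(y\cdot\rho(\tau))(y\cdot\rho(\tau'))\,\langle\tau\otimes\tau|S_v(1)\,\tau'\otimes\tau'\rangle .$$ Let $(a_n)$ be a sequence of positive reals with $a_n\to\infty$ and $a_n/n\to0$, put $Y_n=(X_n-n\bar r)/\sqrt{n a_n}$ and $\tilde\Lambda_n(y)=\ln\mathbb E_{w(n)}(e^{y\cdot Y_n})$. **Proposition.** Assume S and $\mathbb D(v)>0$ (positive definite)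 for all $v\in\mathbb T^d$. For every $y\in\mathbb R^d$, the map $q_y:\mathbb T^d\ni v\mapsto\langle y,\mathbb D(v)y\rangle$ has at least one (global) maximum point. 1. Let $y\in\mathbb R^d$ be such that $q_y$ is constant or has only finitely many maximum points, all of them non-degenerate. Then, for any maximum point $v_1(y)$ of $q_y$, $$\lim_{n\to\infty}\frac1{a_n}\tilde\Lambda_n(a_ny)=\tfrac12\langle y,\mathbb D(v_1(y))y\rangle=:L(y).$$ 2. If the assumption of 1 holds for all $y\in\mathbb R^d\setminus\{0\}$, then $L$ is convex on $\mathbb R^d$. 3. Let $U\subset\mathbb R^d$ be open and $J\in\mathbb N$ be such that, for every $y\in U$, $q_y$ has exactly $J$ maximum points $v_1(y),\dots,v_J(y)$, all of them non-degenerate. Then $L$ is $C^\infty$ on $U$. If this holds with $U=\mathbb R^d\setminus\{0\}$, then $L$ is moreover $C^1$ on $\mathbb R^d$. 4. If $\mathbb D(v)$ does not depend on $v$, or if $d=1$, then $L(y)=\frac12\max_v\langle y,\mathbb D(v)y\rangle$ is $C^\infty$ on $\mathbb R^d$. -/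

import Mathlib

open Filter Topology MeasureTheory Matrix

namespace RandomQW

noncomputable section

/-- The index set `{±1, …, ±d}` of the canonical basis of the coin space `ℂ^{2d}`:
the pair `(j, ε)` stands for `ε (j + 1)`. -/
abbrev CoinIdx (d : ℕ) : Type := Fin d × ℤˣ

/-- A coin matrix: a unitary matrix on `ℂ^{2d}`. -/
abbrev Coin (d : ℕ) : Type := Matrix.unitaryGroup (CoinIdx d) ℂ

/-- Wave functions of a walker on `ℤ^d` with internal state in `ℂ^{2d}`; `ψ x τ` is the
coefficient of `|τ⟩ ⊗ |x⟩`. -/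
abbrev Wave (d : ℕ) : Type := (Fin d → ℤ) → CoinIdx d → ℂ

variable {d : ℕ} {Ω : Type*} [MeasurableSpace Ω]

/-- One step `U = S (C ⊗ 1)`: update of the coin state by `C`, then the shift
`|τ⟩ ⊗ |x⟩ ↦ |τ⟩ ⊗ |x + r(τ)⟩`. -/
def step (r : CoinIdx d → Fin d → ℤ) (C : Coin d) (ψ : Wave d) : Wave d :=
  fun x τ => ((C : Matrix (CoinIdx d) (CoinIdx d) ℂ) *ᵥ ψ (x - r τ)) τ

/-- The state at time `n`, starting from `φ₀ ⊗ |0⟩`, when the coin `C_{k+1}` used at the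
`(k+1)`-st step is `Cs k`. -/
def state (r : CoinIdx d → Fin d → ℤ) (φ₀ : CoinIdx d → ℂ) (Cs : ℕ → Coin d) : ℕ → Wave d
  | 0 => fun x τ => if x = 0 then φ₀ τ else 0
  | n + 1 => step r (Cs n) (state r φ₀ Cs n)

/-- The quantum mechanical probability `W_k(n)` to find the walker at site `k` at time `n`. -/
def siteProb (r : CoinIdx d → Fin d → ℤ) (φ₀ : CoinIdx d → ℂ) (Cs : ℕ → Coin d) (n : ℕ)
    (k : Fin d → ℤ) : ℝ :=
  ∑ τ, ‖state r φ₀ Cs n k τ‖ ^ 2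

/-- The averaged distribution `w_k(n) = 𝔼 (W_k(n))`, the expectation being with respect to the
i.i.d. sequence of coin matrices `C(ω₁), C(ω₂), …` on the product space `(Ω^ℕ, μ^{⊗ℕ})`. -/
def avgProb (μ : Measure Ω) [IsProbabilityMeasure μ] (C : Ω → Coin d)
    (r : CoinIdx d → Fin d → ℤ) (φ₀ : CoinIdx d → ℂ) (n : ℕ) (k : Fin d → ℤ) : ℝ :=
  ∫ ω : ℕ → Ω, siteProb r φ₀ (fun j => C (ω j)) n k ∂(Measure.infinitePi fun _ : ℕ => μ)

/-- The mean jump `r̄ = (1/2d) ∑_τ r(τ)`. -/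
def meanJump (r : CoinIdx d → Fin d → ℤ) : Fin d → ℝ :=
  fun i => (1 / (2 * d : ℝ)) * ∑ τ, (r τ i : ℝ)

/-- `Y_n` at a site: `(k - n r̄) / √(n a_n)`. -/
def rescaledPos (r : CoinIdx d → Fin d → ℤ) (a : ℕ → ℝ) (n : ℕ) (k : Fin d → ℤ) : Fin d → ℝ :=
  fun i => ((k i : ℝ) - n * meanJump r i) / Real.sqrt (n * a n)

/-- The logarithmic generating function `Λ̃_n(y) = ln 𝔼_{w(n)} (exp (y · Y_n))`.
The distribution `w(n)` has finite support, so that the sum over `ℤ^d` is finite. -/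
def logGen (μ : Measure Ω) [IsProbabilityMeasure μ] (C : Ω → Coin d)
    (r : CoinIdx d → Fin d → ℤ) (φ₀ : CoinIdx d → ℂ) (a : ℕ → ℝ) (n : ℕ) (y : Fin d → ℝ) : ℝ :=
  Real.log (∑' k : Fin d → ℤ, avgProb μ C r φ₀ n k * Real.exp (y ⬝ᵥ rescaledPos r a n k))

/-- The matrix `𝓔 = 𝔼 (C(ω) ⊗ conj C(ω))` on `ℂ^{2d} ⊗ ℂ^{2d}`. -/
def meanTensor (μ : Measure Ω) (C : Ω → Coin d) :
    Matrix (CoinIdx d × CoinIdx d) (CoinIdx d × CoinIdx d) ℂ :=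
  Matrix.of fun S T => ∫ ω, (C ω : Matrix (CoinIdx d) (CoinIdx d) ℂ) S.1 T.1 *
    star ((C ω : Matrix (CoinIdx d) (CoinIdx d) ℂ) S.2 T.2) ∂μ

/-- The diagonal matrix `D(y, y')` with entries `exp (i (y · r(τ) + y' · r(τ')))`. -/
def phase (r : CoinIdx d → Fin d → ℤ) (y y' : Fin d → ℝ) :
    Matrix (CoinIdx d × CoinIdx d) (CoinIdx d × CoinIdx d) ℂ :=
  Matrix.diagonal fun T => Complex.exp (Complex.I *
    (((y ⬝ᵥ fun i => (r T.1 i : ℝ)) + (y' ⬝ᵥ fun i => (r T.2 i : ℝ)) : ℝ) : ℂ))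

/-- `𝓜(y, y') = D(y, y') 𝓔`. -/
def avgM (μ : Measure Ω) (C : Ω → Coin d) (r : CoinIdx d → Fin d → ℤ) (y y' : Fin d → ℝ) :
    Matrix (CoinIdx d × CoinIdx d) (CoinIdx d × CoinIdx d) ℂ :=
  phase r y y' * meanTensor μ C

/-- Spectral assumption: for every `v`, the only eigenvalue of `𝓜(-v, v)` on the unit circle
is `1`, and it is simple. -/
def AssumptionS (μ : Measure Ω) (C : Ω → Coin d) (r : CoinIdx d → Fin d → ℤ) : Prop :=
  ∀ v : Fin d → ℝ,
    spectrum ℂ (avgM μ C r (-v) v) ∩ Metric.sphere (0 : ℂ) 1 = {1} ∧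
      (avgM μ C r (-v) v).charpoly.rootMultiplicity 1 = 1

/-- The orthogonal projector `P` onto the line spanned by `∑_τ |τ ⊗ τ⟩`, whose squared norm
is `2d`. -/
def projP (d : ℕ) : Matrix (CoinIdx d × CoinIdx d) (CoinIdx d × CoinIdx d) ℂ :=
  Matrix.of fun S T => if S.1 = S.2 ∧ T.1 = T.2 then 1 / (2 * d : ℂ) else 0

/-- The reduced resolvent `S_v(1)`, where `(𝓜(-v,v) - z)⁻¹ = P / (1 - z) + S_v(z)`. Under the
spectral assumption, `𝓜(-v,v) - 1` maps the range of `1 - P` bijectively to itself, and `S_v(1)`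
is its inverse there and `0` on the range of `P`; so `𝓜(-v,v) - 1 + P` is invertible,
with inverse `S_v(1) + P`. -/
def redResolvent (μ : Measure Ω) (C : Ω → Coin d) (r : CoinIdx d → Fin d → ℤ) (v : Fin d → ℝ) :
    Matrix (CoinIdx d × CoinIdx d) (CoinIdx d × CoinIdx d) ℂ :=
  (avgM μ C r (-v) v - 1 + projP d)⁻¹ - projP d

/-- The diffusion matrix `𝔻(v)`: the real symmetric matrix of the quadratic form
`⟨y, 𝔻(v) y⟩ = -(1/2d) ∑_τ (y · ρ(τ))²
  - (1/d) ∑_{τ,τ'} (y · ρ(τ)) (y · ρ(τ')) ⟨τ⊗τ, S_v(1) τ'⊗τ'⟩`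
with the centred jumps `ρ(τ) = r(τ) - r̄` (the matrix elements of `S_v(1)` which occur
are real). -/
def diffusion (μ : Measure Ω) (C : Ω → Coin d) (r : CoinIdx d → Fin d → ℤ) (v : Fin d → ℝ) :
    Matrix (Fin d) (Fin d) ℝ :=
  let ρ : CoinIdx d → Fin d → ℝ := fun τ i => (r τ i : ℝ) - meanJump r i
  Matrix.of fun j k =>
    -(1 / (2 * d : ℝ)) * ∑ τ, ρ τ j * ρ τ k
      - (1 / (2 * d : ℝ)) * ∑ τ, ∑ τ', (ρ τ j * ρ τ' k + ρ τ k * ρ τ' j) *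
          (redResolvent μ C r v (τ, τ) (τ', τ')).re

/-- `⟨y, 𝔻(v) y⟩`. -/
def quad (μ : Measure Ω) (C : Ω → Coin d) (r : CoinIdx d → Fin d → ℤ) (y v : Fin d → ℝ) : ℝ :=
  y ⬝ᵥ (diffusion μ C r v *ᵥ y)

/-- The (global) maximum points of `v ↦ g v` on the torus, viewed as `[0, 2π)^d`. -/
def maxPoints (g : (Fin d → ℝ) → ℝ) : Set (Fin d → ℝ) :=
  {v | (∀ i, v i ∈ Set.Ico 0 (2 * Real.pi)) ∧ ∀ w, g w ≤ g v}

/-- The Hessian matrix of `g` at `v`. -/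
def hessian (g : (Fin d → ℝ) → ℝ) (v : Fin d → ℝ) : Matrix (Fin d) (Fin d) ℝ :=
  Matrix.of fun j k => iteratedFDeriv ℝ 2 g v ![Pi.single j 1, Pi.single k 1]

/-- `g` has finitely many maximum points on the torus, all of them non-degenerate. -/
def FiniteNondegMax (g : (Fin d → ℝ) → ℝ) : Prop :=
  (maxPoints g).Finite ∧ ∀ v ∈ maxPoints g, (hessian g v).det ≠ 0

/-- `g` is constant, or it has finitely many maximum points, all of them non-degenerate. -/
def ConstOrNondegMax (g : (Fin d → ℝ) → ℝ) : Prop :=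
  (∀ v w, g v = g w) ∨ FiniteNondegMax g

end

end RandomQW

/-! The exponential moment of the centred walk is computed by Plancherel. Tilting the wave function
by half the exponent and taking its Fourier transform turns the walk into a chain on the coin space,
and `tsum_avgProb_mul_exp` writes the moment as the integral over the torus of `tiltedNorm`, the
averaged squared norm at momentum `v`. Since the coins are independent, the averaged density matrix
`corr` obeys a linear recursion whose matrix is `𝓜(-v,v)` multiplied by the tilt `exp (t R)`, with
`R` the diagonal `pairJump`.

The growth rate is found without following an eigenvalue. Second order perturbation theory gives an
explicit vector `η` which is a left eigenvector of the tilted matrix up to `O(t³)`, with eigenvalue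
`1 + t² ⟨y, 𝔻(v) y⟩ / 2` (`exists_approx_eigenvector`). The entries of a density matrix are
dominated by its trace, so pairing with `η` is comparable to the trace and is multiplied at each
step by almost that factor. This gives bounds for `tiltedNorm` that are uniform in `v`
(`exists_tiltedNorm_bounds`).

With `t = √(a_n / n)` one has `n t² = a_n`, while the error `n t³ = a_n t` is `o(a_n)`. Laplace's
principle (`tendsto_log_integral`) then leaves half the maximum of `q_y`.

Consequently `L` is half a maximum over `v` of nonnegative quadratic forms in `y`, hence convex and
homogeneous of degree two. Nondegenerate maximum points continue along smooth branches by the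
inverse function theorem; constancy of their number prevents a branch from losing maximality, so `L`
is smooth (`contDiffOn_max_value`). Homogeneity carries `C¹` regularity across the origin, and gives
a multiple of `y²` when `d = 1`. -/

namespace RandomQW

/-! ### The matrix `𝓜(-v,v)`, its invariant vector and the inverse of `𝓜(-v,v) - 1 + P`. -/

variable {d : ℕ} {Ω : Type*} [MeasurableSpace Ω]

/-- The vector `∑_τ |τ ⊗ τ⟩`. -/
def diagVec (d : ℕ) : CoinIdx d × CoinIdx d → ℂ := fun T => if T.1 = T.2 then 1 else 0

lemma card_coinIdx (d : ℕ) : Fintype.card (CoinIdx d) = 2 * d := by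
  simp [mul_comm]

lemma sum_diagVec_mul (f : CoinIdx d × CoinIdx d → ℂ) :
    ∑ T, diagVec d T * f T = ∑ τ, f (τ, τ) := by
  simp [diagVec, Fintype.sum_prod_type]

lemma projP_eq : projP d = (1 / (2 * d : ℂ)) • vecMulVec (diagVec d) (diagVec d) := by
  ext S T
  simp only [projP, diagVec, of_apply, Matrix.smul_apply, vecMulVec_apply, smul_eq_mul]
  split_ifs <;> simp_all

lemma diagVec_dotProduct_self : diagVec d ⬝ᵥ diagVec d = 2 * d := by
  rw [dotProduct, sum_diagVec_mul]
  simp [diagVec, mul_comm]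

lemma vecMul_projP (x : CoinIdx d × CoinIdx d → ℂ) :
    x ᵥ* projP d = ((∑ τ, x (τ, τ)) / (2 * d)) • diagVec d := by
  rw [projP_eq, vecMul_smul, vecMul_vecMulVec, smul_smul]
  congr 1
  rw [dotProduct_comm, dotProduct, sum_diagVec_mul]
  ring

lemma projP_mulVec (x : CoinIdx d × CoinIdx d → ℂ) :
    projP d *ᵥ x = ((∑ τ, x (τ, τ)) / (2 * d)) • diagVec d := by
  rw [projP_eq, smul_mulVec, vecMulVec_mulVec, op_smul_eq_smul, smul_smul]
  congr 1
  rw [dotProduct, sum_diagVec_mul]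
  ring

lemma projP_mul_self (hd : d ≠ 0) : projP d * projP d = projP d := by
  have : (2 * d : ℂ) ≠ 0 := by simpa using hd
  rw [projP_eq, smul_mul_smul_comm, vecMulVec_mul_vecMulVec, diagVec_dotProduct_self,
    vecMulVec_smul, smul_smul]
  congr 1
  field_simp

lemma integrable_of_forall_norm_le {α : Type*} [MeasurableSpace α] {μ : Measure α}
    [IsFiniteMeasure μ] {f : α → ℂ} (hf : Measurable f) (K : ℝ) (h : ∀ x, ‖f x‖ ≤ K) :
    Integrable f μ :=
  .of_bound hf.aestronglyMeasurable K (ae_of_all _ h)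

lemma norm_coin_le (U : Coin d) (τ σ : CoinIdx d) :
    ‖(U : Matrix (CoinIdx d) (CoinIdx d) ℂ) τ σ‖ ≤ 1 :=
  entry_norm_bound_of_unitary U.2 τ σ

variable {μ : Measure Ω} {C : Ω → Coin d} {r : CoinIdx d → Fin d → ℤ}

/-- The phases at `-v` and `v` cancel on the indices `(τ, τ)`, the only ones where `diagVec` lives.
-/
lemma phase_mulVec_diagVec (v : Fin d → ℝ) : phase r (-v) v *ᵥ diagVec d = diagVec d := by
  ext ⟨τ, σ⟩
  rw [phase, mulVec_diagonal]
  by_cases h : τ = σ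
  · subst h; simp
  · simp [diagVec, h]

lemma diagVec_vecMul_phase (v : Fin d → ℝ) : diagVec d ᵥ* phase r (-v) v = diagVec d := by
  ext ⟨τ, σ⟩
  rw [phase, vecMul_diagonal]
  by_cases h : τ = σ
  · subst h; simp
  · simp [diagVec, h]

lemma measurable_coin_mul_star
    (hC : ∀ τ σ, Measurable fun ω => (C ω : Matrix (CoinIdx d) (CoinIdx d) ℂ) τ σ)
    (S T : CoinIdx d × CoinIdx d) :
    Measurable fun ω => (C ω : Matrix (CoinIdx d) (CoinIdx d) ℂ) S.1 T.1 *
      star ((C ω : Matrix (CoinIdx d) (CoinIdx d) ℂ) S.2 T.2) :=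
  (hC _ _).mul (continuous_star.measurable.comp (hC _ _))

variable (μ C r) in
/-- The invertible matrix `𝓜(-v,v) - 1 + P`. -/
noncomputable def shiftedM (v : Fin d → ℝ) :
    Matrix (CoinIdx d × CoinIdx d) (CoinIdx d × CoinIdx d) ℂ :=
  avgM μ C r (-v) v - 1 + projP d

variable (μ C r) in
/-- The inverse of `𝓜(-v,v) - 1 + P`. -/
noncomputable def resolv (v : Fin d → ℝ) :
    Matrix (CoinIdx d × CoinIdx d) (CoinIdx d × CoinIdx d) ℂ :=
  (shiftedM μ C r v)⁻¹

lemma redResolvent_eq (v : Fin d → ℝ) :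
    redResolvent μ C r v = resolv μ C r v - projP d := rfl

/-- Exchanging the tensor factors and conjugating is a symmetry of `𝓜(-v,v)`. It passes to the
inverse, and on indices `(τ, τ)`, which the swap fixes, it makes the entries of `resolv` real. -/
lemma star_avgM_swap (v : Fin d → ℝ) (S T : CoinIdx d × CoinIdx d) :
    star (avgM μ C r (-v) v S.swap T.swap) = avgM μ C r (-v) v S T := by
  simp only [avgM, phase, diagonal_mul, meanTensor, of_apply, star_mul', Prod.fst_swap,
    Prod.snd_swap]
  congr 1
  · rw [Complex.star_def, ← Complex.exp_conj]
    congr 1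
    simp only [map_mul, Complex.conj_I, Complex.conj_ofReal, neg_dotProduct]
    push_cast
    ring
  · rw [Complex.star_def, ← integral_conj]
    congr 1
    ext ω
    simp [mul_comm]

lemma star_resolv_swap (v : Fin d → ℝ) (S T : CoinIdx d × CoinIdx d) :
    star (resolv μ C r v S.swap T.swap) = resolv μ C r v S T := by
  -- `ᴴᵀ` is entrywise conjugation; in this form it visibly commutes with inversion.
  have h : ((shiftedM μ C r v).submatrix (Equiv.prodComm _ _) (Equiv.prodComm _ _))ᴴᵀ
      = shiftedM μ C r v := by
    ext S T
    simp only [transpose_apply, conjTranspose_apply, submatrix_apply, shiftedM, Matrix.add_apply,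
      Matrix.sub_apply, star_add, star_sub, Equiv.coe_prodComm, star_avgM_swap]
    congr 2
    · simp [one_apply, Prod.swap_inj, apply_ite]
    · simp only [projP, of_apply, Prod.fst_swap, Prod.snd_swap]
      simp only [eq_comm (a := S.2), eq_comm (a := T.2)]
      split_ifs <;> simp
  have h2 : ((resolv μ C r v).submatrix (Equiv.prodComm _ _) (Equiv.prodComm _ _))ᴴᵀ
      = resolv μ C r v := by
    conv_rhs => rw [resolv, ← h, ← transpose_nonsing_inv, ← conjTranspose_nonsing_inv,
      inv_submatrix_equiv]
    rfl
  exact congrFun (congrFun h2 S) T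

lemma resolv_diag_im (v : Fin d → ℝ) (τ σ : CoinIdx d) :
    (((resolv μ C r v (τ, τ) (σ, σ)).re : ℝ) : ℂ) = resolv μ C r v (τ, τ) (σ, σ) :=
  Complex.conj_eq_iff_re.1 (star_resolv_swap v (τ, τ) (σ, σ))

variable [IsProbabilityMeasure μ]

lemma integrable_coin_mul_star
    (hC : ∀ τ σ, Measurable fun ω => (C ω : Matrix (CoinIdx d) (CoinIdx d) ℂ) τ σ)
    (S T : CoinIdx d × CoinIdx d) :
    Integrable (fun ω => (C ω : Matrix (CoinIdx d) (CoinIdx d) ℂ) S.1 T.1 *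
      star ((C ω : Matrix (CoinIdx d) (CoinIdx d) ℂ) S.2 T.2)) μ := by
  refine integrable_of_forall_norm_le (measurable_coin_mul_star hC S T) 1 fun ω => ?_
  rw [norm_mul, norm_star]
  exact mul_le_one₀ (norm_coin_le _ _ _) (norm_nonneg _) (norm_coin_le _ _ _)

/-- This is `C C* = 1` averaged; the version for row vectors below is `C* C = 1`. -/
lemma meanTensor_mulVec_diagVec
    (hC : ∀ τ σ, Measurable fun ω => (C ω : Matrix (CoinIdx d) (CoinIdx d) ℂ) τ σ) :
    meanTensor μ C *ᵥ diagVec d = diagVec d := by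
  ext S
  rw [mulVec, dotProduct_comm, dotProduct, sum_diagVec_mul]
  simp only [meanTensor, of_apply]
  rw [← integral_finsetSum _ fun τ _ => integrable_coin_mul_star hC S (τ, τ)]
  have : ∀ ω, ∑ τ, (C ω : Matrix (CoinIdx d) (CoinIdx d) ℂ) S.1 τ *
      star ((C ω : Matrix (CoinIdx d) (CoinIdx d) ℂ) S.2 τ) = diagVec d S := by
    intro ω
    have h := congrFun (congrFun (mem_unitaryGroup_iff.1 (C ω).2) S.1) S.2
    simpa [mul_apply, star_apply, one_apply, diagVec] using h
  simp only [this, integral_const, probReal_univ, one_smul]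

lemma diagVec_vecMul_meanTensor
    (hC : ∀ τ σ, Measurable fun ω => (C ω : Matrix (CoinIdx d) (CoinIdx d) ℂ) τ σ) :
    diagVec d ᵥ* meanTensor μ C = diagVec d := by
  ext T
  rw [vecMul, dotProduct, sum_diagVec_mul]
  simp only [meanTensor, of_apply]
  rw [← integral_finsetSum _ fun τ _ => integrable_coin_mul_star hC (τ, τ) T]
  have : ∀ ω, ∑ τ, (C ω : Matrix (CoinIdx d) (CoinIdx d) ℂ) τ T.1 *
      star ((C ω : Matrix (CoinIdx d) (CoinIdx d) ℂ) τ T.2) = diagVec d T := by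
    intro ω
    have h := congrFun (congrFun (mem_unitaryGroup_iff'.1 (C ω).2) T.2) T.1
    simpa [mul_apply, star_apply, one_apply, diagVec, mul_comm, eq_comm] using h
  simp only [this, integral_const, probReal_univ, one_smul]

lemma avgM_mulVec_diagVec
    (hC : ∀ τ σ, Measurable fun ω => (C ω : Matrix (CoinIdx d) (CoinIdx d) ℂ) τ σ)
    (v : Fin d → ℝ) : avgM μ C r (-v) v *ᵥ diagVec d = diagVec d := by
  rw [avgM, ← mulVec_mulVec, meanTensor_mulVec_diagVec hC, phase_mulVec_diagVec]

lemma diagVec_vecMul_avgM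
    (hC : ∀ τ σ, Measurable fun ω => (C ω : Matrix (CoinIdx d) (CoinIdx d) ℂ) τ σ)
    (v : Fin d → ℝ) : diagVec d ᵥ* avgM μ C r (-v) v = diagVec d := by
  rw [avgM, ← vecMul_vecMul, diagVec_vecMul_phase, diagVec_vecMul_meanTensor hC]

lemma avgM_mul_projP
    (hC : ∀ τ σ, Measurable fun ω => (C ω : Matrix (CoinIdx d) (CoinIdx d) ℂ) τ σ)
    (v : Fin d → ℝ) : avgM μ C r (-v) v * projP d = projP d := by
  rw [projP_eq, mul_smul_comm, mul_vecMulVec, avgM_mulVec_diagVec hC]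

lemma projP_mul_avgM
    (hC : ∀ τ σ, Measurable fun ω => (C ω : Matrix (CoinIdx d) (CoinIdx d) ℂ) τ σ)
    (v : Fin d → ℝ) : projP d * avgM μ C r (-v) v = projP d := by
  rw [projP_eq, smul_mul_assoc, vecMulVec_mul, diagVec_vecMul_avgM hC]

/-- A kernel vector `x` satisfies `P x = 0`, because `P 𝓜 = P`, and therefore `𝓜 x = x`. The
algebraic multiplicity of the eigenvalue `1` bounds the geometric one, so `x` is proportional to
`diagVec`, which `P` fixes: a contradiction. -/
lemma isUnit_det_shiftedM (hd : d ≠ 0)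
    (hC : ∀ τ σ, Measurable fun ω => (C ω : Matrix (CoinIdx d) (CoinIdx d) ℂ) τ σ)
    (hS : AssumptionS μ C r) (v : Fin d → ℝ) : IsUnit (shiftedM μ C r v).det := by
  rw [isUnit_iff_ne_zero]
  intro h0
  obtain ⟨x, hx, hx0⟩ := exists_mulVec_eq_zero_iff.2 h0
  have hPx : projP d *ᵥ x = 0 := by
    have := congrArg (fun w => projP d *ᵥ w) hx0
    simpa [shiftedM, mulVec_mulVec, mul_add, mul_sub, projP_mul_avgM hC, projP_mul_self hd]
      using this
  have hMx : avgM μ C r (-v) v *ᵥ x = x := by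
    have := hx0
    rw [shiftedM, add_mulVec, hPx, sub_mulVec, one_mulVec, add_zero, sub_eq_zero] at this
    exact this
  set f : Module.End ℂ (CoinIdx d × CoinIdx d → ℂ) := toLin' (avgM μ C r (-v) v) with hf
  have hle : Module.finrank ℂ (f.eigenspace 1) ≤ 1 := by
    have := f.finrank_eigenspace_le 1
    rwa [hf, charpoly_toLin', (hS v).2] at this
  have hx' : x ∈ f.eigenspace 1 := by
    rw [Module.End.mem_eigenspace_iff]; simpa [hf] using hMx
  have hψ' : diagVec d ∈ f.eigenspace 1 := by
    rw [Module.End.mem_eigenspace_iff]; simpa [hf] using avgM_mulVec_diagVec hC v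
  have hψ0 : diagVec d ≠ 0 := fun h => by
    have := diagVec_dotProduct_self (d := d)
    rw [h, zero_dotProduct] at this
    have h2 : (2 * d : ℂ) ≠ 0 := by simpa using hd
    exact h2 this.symm
  obtain ⟨c, hc⟩ := (finrank_le_one_iff.1 hle)
  obtain ⟨α, hα⟩ := hc ⟨x, hx'⟩
  obtain ⟨β, hβ⟩ := hc ⟨diagVec d, hψ'⟩
  have hα' : α • (c : _ → ℂ) = x := congrArg Subtype.val hα
  have hβ' : β • (c : _ → ℂ) = diagVec d := congrArg Subtype.val hβ
  have hα0 : α ≠ 0 := by rintro rfl; exact hx (by simpa using hα'.symm)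
  have hPψ : projP d *ᵥ diagVec d = diagVec d := by
    rw [projP_mulVec]
    have h2 : (2 * d : ℂ) ≠ 0 := by simpa using hd
    have : (∑ τ : CoinIdx d, diagVec d (τ, τ)) = 2 * d := by simp [diagVec, mul_comm]
    rw [this, div_self h2, one_smul]
  have hc0 : projP d *ᵥ (c : _ → ℂ) = 0 := by
    rw [← hα', mulVec_smul] at hPx
    exact (smul_eq_zero.1 hPx).resolve_left hα0
  rw [← hβ', mulVec_smul, hc0, smul_zero, hβ'] at hPψ
  exact hψ0 hPψ.symm

/-- The solution of `ζ (𝓜(-v,v) - 1) = x` for a row vector `x` with `x P = 0`. -/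
lemma vecMul_resolv_vecMul_avgM (hd : d ≠ 0)
    (hC : ∀ τ σ, Measurable fun ω => (C ω : Matrix (CoinIdx d) (CoinIdx d) ℂ) τ σ)
    (hS : AssumptionS μ C r) (v : Fin d → ℝ) (x : CoinIdx d × CoinIdx d → ℂ)
    (hx : ∑ τ, x (τ, τ) = 0) :
    (x ᵥ* resolv μ C r v) ᵥ* avgM μ C r (-v) v = x ᵥ* resolv μ C r v + x := by
  have h1 : (x ᵥ* resolv μ C r v) ᵥ* shiftedM μ C r v = x := by
    rw [vecMul_vecMul, resolv, nonsing_inv_mul _ (isUnit_det_shiftedM hd hC hS v), vecMul_one]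
  have hxP : x ᵥ* projP d = 0 := by rw [vecMul_projP, hx, zero_div, zero_smul]
  -- Since `(𝓜 - 1 + P) P = P`, the vectors `x` and `x (𝓜 - 1 + P)⁻¹` have the same product with
  -- `P`.
  have h2 : (x ᵥ* resolv μ C r v) ᵥ* projP d = 0 := by
    have : shiftedM μ C r v * projP d = projP d := by
      rw [shiftedM, add_mul, sub_mul, avgM_mul_projP hC, one_mul, sub_self, zero_add,
        projP_mul_self hd]
    rw [← hxP]
    conv_rhs => rw [← h1]
    rw [vecMul_vecMul _ (shiftedM μ C r v), this]
  rw [shiftedM, vecMul_add, h2, add_zero, vecMul_sub, vecMul_one, sub_eq_iff_eq_add] at h1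
  rw [h1, add_comm]

end RandomQW

/-! ### Smoothness and periodicity in `v` of the diffusion form. -/

namespace RandomQW

section Smooth

variable {E : Type*} [NormedAddCommGroup E] [NormedSpace ℝ E] {ι : Type*} [Fintype ι]
  [DecidableEq ι]

lemma contDiff_det {n : WithTop ℕ∞} {A : E → Matrix ι ι ℂ}
    (hA : ∀ i j, ContDiff ℝ n fun v => A v i j) : ContDiff ℝ n fun v => (A v).det := by
  simp only [det_apply']
  exact ContDiff.sum fun σ _ => contDiff_const.mul (contDiff_prod fun i _ => hA _ _)

lemma contDiff_adjugate {n : WithTop ℕ∞} {A : E → Matrix ι ι ℂ}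
    (hA : ∀ i j, ContDiff ℝ n fun v => A v i j) (i j : ι) :
    ContDiff ℝ n fun v => (A v).adjugate i j := by
  simp only [adjugate_apply]
  refine contDiff_det fun k l => ?_
  by_cases h : k = j
  · subst h; simpa using contDiff_const
  · simpa [updateRow_ne h] using hA k l

/-- By Cramer's rule the inverse is a quotient of polynomials in the entries. -/
lemma contDiff_inv {n : WithTop ℕ∞} {A : E → Matrix ι ι ℂ}
    (hA : ∀ i j, ContDiff ℝ n fun v => A v i j) (hdet : ∀ v, IsUnit (A v).det) (i j : ι) :
    ContDiff ℝ n fun v => (A v)⁻¹ i j := by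
  simp only [inv_def, Matrix.smul_apply, Ring.inverse_eq_inv', smul_eq_mul]
  exact ((contDiff_det hA).inv fun v => (hdet v).ne_zero).mul (contDiff_adjugate hA i j)

end Smooth

variable {d : ℕ} {Ω : Type*} [MeasurableSpace Ω] {μ : Measure Ω} {C : Ω → Coin d}
  {r : CoinIdx d → Fin d → ℤ}

variable (r) in
/-- The component `y · ρ(τ)` of the centred jump in the direction `y`. -/
noncomputable def centredJump (y : Fin d → ℝ) (τ : CoinIdx d) : ℝ :=
  y ⬝ᵥ fun i => (r τ i : ℝ) - meanJump r i

lemma sum_centredJump (hd : d ≠ 0) (y : Fin d → ℝ) : ∑ τ, centredJump r y τ = 0 := by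
  have h2 : (2 * d : ℝ) ≠ 0 := by simpa using hd
  simp only [centredJump, dotProduct]
  rw [Finset.sum_comm]
  refine Finset.sum_eq_zero fun i _ => ?_
  rw [← Finset.mul_sum, Finset.sum_sub_distrib, Finset.sum_const, Finset.card_univ, card_coinIdx,
    nsmul_eq_mul, meanJump]
  push_cast
  field_simp
  simp

/-- `redResolvent` may be replaced by `resolv`: they differ by `P`, whose diagonal-pair entries are
all equal, and the centred jumps sum to zero. -/
lemma quad_eq (hd : d ≠ 0) (y v : Fin d → ℝ) :
    quad μ C r y v = -(1 / (2 * d : ℝ)) * ∑ τ, centredJump r y τ ^ 2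
      - (1 / d : ℝ) * ∑ τ, ∑ τ', centredJump r y τ * centredJump r y τ' *
          (resolv μ C r v (τ, τ) (τ', τ')).re := by
  have hd' : (d : ℝ) ≠ 0 := by simpa using hd
  have hre : ∀ τ τ', (redResolvent μ C r v (τ, τ) (τ', τ')).re =
      (resolv μ C r v (τ, τ) (τ', τ')).re - 1 / (2 * d) := by
    intro τ τ'
    rw [redResolvent_eq, Matrix.sub_apply, Complex.sub_re]
    congr 1
    simp only [projP, of_apply, and_self, if_true]
    rw [show (1 / (2 * d : ℂ)) = ((1 / (2 * d : ℝ) : ℝ) : ℂ) by push_cast; rfl, Complex.ofReal_re]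
  have h1 : quad μ C r y v = -(1 / (2 * d : ℝ)) * ∑ τ, centredJump r y τ ^ 2
      - (1 / (2 * d) : ℝ) * ∑ τ, ∑ τ', (centredJump r y τ * centredJump r y τ' +
          centredJump r y τ * centredJump r y τ') * (redResolvent μ C r v (τ, τ) (τ', τ')).re := by
    have hA : ∀ τ τ', centredJump r y τ * centredJump r y τ' =
        ∑ j, ∑ k, y j * (((r τ j : ℝ) - meanJump r j) * ((r τ' k : ℝ) - meanJump r k)) * y k := by
      intro τ τ'
      simp only [centredJump, dotProduct, Finset.sum_mul_sum]
      exact Finset.sum_congr rfl fun j _ => Finset.sum_congr rfl fun k _ => by ring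
    have hB : ∀ τ τ', centredJump r y τ * centredJump r y τ' =
        ∑ j, ∑ k, y j * (((r τ k : ℝ) - meanJump r k) * ((r τ' j : ℝ) - meanJump r j)) * y k := by
      intro τ τ'
      rw [mul_comm, hA]
      exact Finset.sum_congr rfl fun j _ => Finset.sum_congr rfl fun k _ => by ring
    have hC : ∀ τ τ', (centredJump r y τ * centredJump r y τ' +
          centredJump r y τ * centredJump r y τ') * (redResolvent μ C r v (τ, τ) (τ', τ')).re
        = ∑ j, ∑ k, y j * ((((r τ j : ℝ) - meanJump r j) * ((r τ' k : ℝ) - meanJump r k) +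
            ((r τ k : ℝ) - meanJump r k) * ((r τ' j : ℝ) - meanJump r j)) *
            (redResolvent μ C r v (τ, τ) (τ', τ')).re) * y k := by
      intro τ τ'
      nth_rewrite 1 [hA]
      rw [hB, ← Finset.sum_add_distrib, Finset.sum_mul]
      refine Finset.sum_congr rfl fun j _ => ?_
      rw [← Finset.sum_add_distrib, Finset.sum_mul]
      exact Finset.sum_congr rfl fun k _ => by ring
    simp only [hC]
    simp only [pow_two, hA]
    have sw1 : ∀ f : CoinIdx d → Fin d → Fin d → ℝ,
        ∑ τ, ∑ j, ∑ k, f τ j k = ∑ j, ∑ k, ∑ τ, f τ j k := by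
      intro f
      rw [Finset.sum_comm]
      exact Finset.sum_congr rfl fun j _ => Finset.sum_comm
    have sw2 : ∀ f : CoinIdx d → CoinIdx d → Fin d → Fin d → ℝ,
        ∑ τ, ∑ τ', ∑ j, ∑ k, f τ τ' j k = ∑ j, ∑ k, ∑ τ, ∑ τ', f τ τ' j k := by
      intro f
      simp only [sw1]
    rw [sw1, sw2, Finset.mul_sum, Finset.mul_sum, ← Finset.sum_sub_distrib]
    rw [quad, dotProduct]
    refine Finset.sum_congr rfl fun j _ => ?_
    rw [mulVec, dotProduct, Finset.mul_sum, Finset.mul_sum, Finset.mul_sum,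
      ← Finset.sum_sub_distrib]
    refine Finset.sum_congr rfl fun k _ => ?_
    simp only [diffusion, of_apply]
    simp only [← Finset.mul_sum, ← Finset.sum_mul]
    ring
  rw [h1]
  congr 1
  simp only [hre, mul_sub, Finset.sum_sub_distrib]
  have h0 : ∑ τ, ∑ τ', (centredJump r y τ * centredJump r y τ' +
      centredJump r y τ * centredJump r y τ') * (1 / (2 * d : ℝ)) = 0 := by
    simp only [← two_mul, ← mul_assoc, ← Finset.sum_mul, ← Finset.mul_sum, sum_centredJump hd]
    simp
  rw [h0, mul_zero, sub_zero, Finset.mul_sum, Finset.mul_sum]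
  refine Finset.sum_congr rfl fun τ _ => ?_
  rw [Finset.mul_sum, Finset.mul_sum]
  refine Finset.sum_congr rfl fun τ' _ => ?_
  field_simp
  ring

lemma quad_smul (c : ℝ) (y v : Fin d → ℝ) : quad μ C r (c • y) v = c ^ 2 * quad μ C r y v := by
  simp only [quad, mulVec_smul, dotProduct_smul, smul_dotProduct, smul_eq_mul]
  ring

lemma quad_zero (v : Fin d → ℝ) : quad μ C r 0 v = 0 := by simp [quad]

lemma contDiff_avgM {n : WithTop ℕ∞} (S T : CoinIdx d × CoinIdx d) :
    ContDiff ℝ n fun v => avgM μ C r (-v) v S T := by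
  simp only [avgM, phase, diagonal_mul]
  refine ContDiff.mul ?_ contDiff_const
  refine (Complex.contDiff_exp (𝕜 := ℝ)).comp ?_
  refine contDiff_const.mul (Complex.ofRealCLM.contDiff.comp ?_)
  simp only [dotProduct, Pi.neg_apply]
  exact ContDiff.add (by fun_prop) (by fun_prop)

lemma contDiff_shiftedM {n : WithTop ℕ∞} (S T : CoinIdx d × CoinIdx d) :
    ContDiff ℝ n fun v => shiftedM μ C r v S T := by
  simp only [shiftedM, Matrix.add_apply, Matrix.sub_apply]
  exact ((contDiff_avgM S T).sub contDiff_const).add contDiff_const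

/-- The jumps are integer vectors, so the exponents change by integer multiples of `2πi`. -/
lemma shiftedM_add_period (v : Fin d → ℝ) (k : Fin d → ℤ) :
    shiftedM μ C r (v + fun i => 2 * Real.pi * k i) = shiftedM μ C r v := by
  simp only [shiftedM, avgM]
  congr 3
  rw [phase, phase]
  congr 1
  ext T
  rw [Complex.exp_eq_exp_iff_exists_int]
  refine ⟨∑ i, (k i * r T.2 i - k i * r T.1 i), ?_⟩
  simp only [dotProduct, Pi.neg_apply, Pi.add_apply, Complex.ofReal_add, Complex.ofReal_sum]
  push_cast
  rw [← Finset.sum_add_distrib, ← Finset.sum_add_distrib, Finset.mul_sum, Finset.mul_sum,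
    Finset.sum_mul, ← Finset.sum_add_distrib]
  exact Finset.sum_congr rfl fun i _ => by ring

lemma resolv_add_period (v : Fin d → ℝ) (k : Fin d → ℤ) :
    resolv μ C r (v + fun i => 2 * Real.pi * k i) = resolv μ C r v := by
  rw [resolv, shiftedM_add_period, resolv]

lemma quad_add_period (y v : Fin d → ℝ) (k : Fin d → ℤ) :
    quad μ C r y (v + fun i => 2 * Real.pi * k i) = quad μ C r y v := by
  simp only [quad, diffusion, redResolvent_eq, resolv_add_period]

variable [IsProbabilityMeasure μ]

lemma contDiff_resolv (hd : d ≠ 0)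
    (hC : ∀ τ σ, Measurable fun ω => (C ω : Matrix (CoinIdx d) (CoinIdx d) ℂ) τ σ)
    (hS : AssumptionS μ C r) {n : WithTop ℕ∞} (S T : CoinIdx d × CoinIdx d) :
    ContDiff ℝ n fun v => resolv μ C r v S T :=
  contDiff_inv contDiff_shiftedM (isUnit_det_shiftedM hd hC hS) S T

lemma contDiff_diffusion (hd : d ≠ 0)
    (hC : ∀ τ σ, Measurable fun ω => (C ω : Matrix (CoinIdx d) (CoinIdx d) ℂ) τ σ)
    (hS : AssumptionS μ C r) {n : WithTop ℕ∞} (j k : Fin d) :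
    ContDiff ℝ n fun v => diffusion μ C r v j k := by
  simp only [diffusion, of_apply, redResolvent_eq, Matrix.sub_apply]
  refine contDiff_const.sub (contDiff_const.mul (ContDiff.sum fun τ _ => ContDiff.sum fun τ' _ =>
    contDiff_const.mul ?_))
  exact Complex.reCLM.contDiff.comp ((contDiff_resolv hd hC hS _ _).sub contDiff_const)

lemma contDiff_quad (hd : d ≠ 0)
    (hC : ∀ τ σ, Measurable fun ω => (C ω : Matrix (CoinIdx d) (CoinIdx d) ℂ) τ σ)
    (hS : AssumptionS μ C r) {n : WithTop ℕ∞} :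
    ContDiff ℝ n fun p : (Fin d → ℝ) × (Fin d → ℝ) => quad μ C r p.1 p.2 := by
  simp only [quad, dotProduct, mulVec]
  have h1 : ∀ i, ContDiff ℝ n fun p : (Fin d → ℝ) × (Fin d → ℝ) => p.1 i := fun i => by fun_prop
  refine ContDiff.sum fun j _ => (h1 j).mul (ContDiff.sum fun k _ => ContDiff.mul ?_ (h1 k))
  exact (contDiff_diffusion hd hC hS j k).comp contDiff_snd

/-! ### Representatives in the fundamental cube `[0, 2π)^d`. -/

section Torus

lemma exists_sub_period_mem (v : Fin d → ℝ) : ∃ k : Fin d → ℤ,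
    ∀ i, (v + fun i => 2 * Real.pi * k i) i ∈ Set.Ico 0 (2 * Real.pi) := by
  have hp := Real.two_pi_pos
  refine ⟨fun i => -⌊v i / (2 * Real.pi)⌋, fun i => ?_⟩
  have h1 := Int.floor_le (v i / (2 * Real.pi))
  have h2 := Int.lt_floor_add_one (v i / (2 * Real.pi))
  rw [le_div_iff₀ hp] at h1
  rw [div_lt_iff₀ hp] at h2
  simp only [Pi.add_apply]
  push_cast
  constructor <;> nlinarith

lemma eq_of_add_period_eq {v w : Fin d → ℝ} (hv : ∀ i, v i ∈ Set.Ico 0 (2 * Real.pi))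
    (hw : ∀ i, w i ∈ Set.Ico 0 (2 * Real.pi)) (k l : Fin d → ℤ)
    (h : (v + fun i => 2 * Real.pi * k i) = w + fun i => 2 * Real.pi * l i) : v = w := by
  have hp := Real.two_pi_pos
  ext i
  have hi := congrFun h i
  simp only [Pi.add_apply] at hi
  obtain ⟨a1, a2⟩ := hv i
  obtain ⟨b1, b2⟩ := hw i
  have e : v i - w i = 2 * Real.pi * ((l i - k i : ℤ) : ℝ) := by push_cast; linarith
  have h1 : (l i - k i : ℤ) < 1 := by
    have : ((l i - k i : ℤ) : ℝ) < 1 := by nlinarith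
    exact_mod_cast this
  have h2 : -1 < (l i - k i : ℤ) := by
    have : (-1 : ℝ) < ((l i - k i : ℤ) : ℝ) := by nlinarith
    exact_mod_cast this
  have h3 : (l i - k i : ℤ) = 0 := by omega
  rw [h3] at e
  simp at e
  linarith

lemma maxPoints_nonempty {g : (Fin d → ℝ) → ℝ} (hg : Continuous g)
    (hper : ∀ v (k : Fin d → ℤ), g (v + fun i => 2 * Real.pi * k i) = g v) :
    (maxPoints g).Nonempty := by
  have hK : IsCompact (Set.Icc (0 : Fin d → ℝ) fun _ => 2 * Real.pi) := isCompact_Icc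
  obtain ⟨v, -, hv⟩ := hK.exists_isMaxOn ⟨0, le_rfl, fun _ => Real.two_pi_pos.le⟩ hg.continuousOn
  have hmax : ∀ w, g w ≤ g v := by
    intro w
    obtain ⟨k, hk⟩ := exists_sub_period_mem w
    rw [← hper w k]
    exact hv ⟨fun i => (hk i).1, fun i => (hk i).2.le⟩
  obtain ⟨k, hk⟩ := exists_sub_period_mem v
  exact ⟨_, hk, fun w => by rw [hper]; exact hmax w⟩

end Torus

end RandomQW

/-! ### Second order perturbation theory for the tilted matrix. -/

namespace RandomQW

lemma norm_exp_neg_expansion {t R K : ℝ} (ht : 0 ≤ t) (htK : t * K ≤ 1) (hR : |R| ≤ K) :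
    ‖Complex.exp (-(t * R : ℝ)) - 1‖ ≤ 2 * (t * K) ∧
    ‖Complex.exp (-(t * R : ℝ)) - 1 + (t * R : ℝ)‖ ≤ (t * K) ^ 2 ∧
    ‖Complex.exp (-(t * R : ℝ)) - 1 + (t * R : ℝ) - (t * R : ℝ) ^ 2 / 2‖ ≤ (t * K) ^ 3 := by
  have hx : ‖(-((t * R : ℝ) : ℂ))‖ ≤ t * K := by
    rw [norm_neg, Complex.norm_real, Real.norm_eq_abs, abs_mul, abs_of_nonneg ht]
    gcongr
  have hx1 := hx.trans htK
  refine ⟨(Complex.norm_exp_sub_one_le hx1).trans (by gcongr), ?_, ?_⟩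
  · have := Complex.norm_exp_sub_one_sub_id_le hx1
    rw [sub_neg_eq_add] at this
    exact this.trans (by gcongr)
  · have := Complex.exp_bound hx1 (n := 3) (by norm_num)
    simp only [Finset.sum_range_succ, Finset.sum_range_zero, Nat.factorial] at this
    have e : Complex.exp (-(t * R : ℝ)) - 1 + (t * R : ℝ) - ((t * R : ℝ) : ℂ) ^ 2 / 2 =
        Complex.exp (-(t * R : ℝ)) - (0 + (-((t * R : ℝ) : ℂ)) ^ 0 / ((1 : ℕ) : ℂ) +
          (-((t * R : ℝ) : ℂ)) ^ 1 / (((0 + 1) * 1 : ℕ) : ℂ) +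
          (-((t * R : ℝ) : ℂ)) ^ 2 / (((1 + 1) * ((0 + 1) * 1) : ℕ) : ℂ)) := by
      push_cast; ring
    rw [e]
    refine this.trans ?_
    calc _ ≤ ‖(-((t * R : ℝ) : ℂ))‖ ^ 3 * 1 := by
            gcongr
            norm_num [Nat.factorial]
      _ ≤ _ := by rw [mul_one]; gcongr

/-- Pointwise second order perturbation estimate for the approximate left eigenvector. -/
lemma norm_perturbation_le {t K R l : ℝ} {p ζ ζ₂ : ℂ} (ht : 0 ≤ t) (ht1 : t ≤ 1)
    (hK : 1 ≤ K) (htK : t * K ≤ 1) (hR : |R| ≤ K) (hl : |l| ≤ K) (hp : ‖p‖ ≤ 1) (hζ : ‖ζ‖ ≤ K)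
    (hζ₂ : ‖ζ₂‖ ≤ K) :
    ‖(p + t * ζ + t ^ 2 * ζ₂) * Complex.exp (-(t * R : ℝ)) - p‖ ≤ 8 * K * t ∧
    ‖p + t * (ζ - p * R) + t ^ 2 * (ζ₂ + (l * p - (ζ * R - 1 / 2 * (p * R ^ 2)))) -
      ((1 + t ^ 2 * l : ℝ) : ℂ) * ((p + t * ζ + t ^ 2 * ζ₂) * Complex.exp (-(t * R : ℝ)))‖
      ≤ 12 * K ^ 3 * t ^ 3 := by
  obtain ⟨h1, h2, h3⟩ := norm_exp_neg_expansion ht htK hR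
  set e := Complex.exp (-(t * R : ℝ)) with he
  have hK0 : 0 ≤ K := zero_le_one.trans hK
  have hnt : ‖(t : ℂ)‖ = t := by rw [Complex.norm_real, Real.norm_of_nonneg ht]
  have hnl : ‖(l : ℂ)‖ ≤ K := by rwa [Complex.norm_real, Real.norm_eq_abs]
  have he3 : ‖e‖ ≤ 3 := by
    calc ‖e‖ = ‖(e - 1) + 1‖ := by rw [sub_add_cancel]
      _ ≤ ‖e - 1‖ + ‖(1 : ℂ)‖ := norm_add_le _ _
      _ ≤ 2 * (t * K) + 1 := by rw [norm_one]; gcongr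
      _ ≤ 3 := by linarith
  have hb : ‖t * ζ * e + t ^ 2 * ζ₂ * e‖ ≤ 6 * K * t := by
    calc _ ≤ ‖t * ζ * e‖ + ‖t ^ 2 * ζ₂ * e‖ := norm_add_le _ _
      _ = t * ‖ζ‖ * ‖e‖ + t ^ 2 * ‖ζ₂‖ * ‖e‖ := by
        simp only [norm_mul, norm_pow, hnt]
      _ ≤ t * K * 3 + t * K * 3 := by
        have : t ^ 2 ≤ t := by nlinarith
        gcongr
      _ = _ := by ring
  have hpu : ‖p * (e - 1)‖ ≤ 2 * (t * K) := by
    rw [norm_mul]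
    calc _ ≤ 1 * (2 * (t * K)) := by gcongr
      _ = _ := one_mul _
  constructor
  · calc _ = ‖p * (e - 1) + (t * ζ * e + t ^ 2 * ζ₂ * e)‖ := by congr 1; ring
      _ ≤ 2 * (t * K) + 6 * K * t := (norm_add_le _ _).trans (add_le_add hpu hb)
      _ = _ := by ring
  -- The terms of order at most two cancel, and each of the four remainders is of order `t³`. Their
  -- bounds add up to `2 K³ + 10 K²` times `t³`, which `K ≥ 1` turns into `12 K³ t³`.
  · have key : p + t * (ζ - p * R) + t ^ 2 * (ζ₂ + (l * p - (ζ * R - 1 / 2 * (p * R ^ 2)))) -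
      ((1 + t ^ 2 * l : ℝ) : ℂ) * ((p + t * ζ + t ^ 2 * ζ₂) * e) =
      -(p * (e - 1 + (t * R : ℝ) - (t * R : ℝ) ^ 2 / 2)) + -(t * ζ * (e - 1 + (t * R : ℝ))) +
        -(t ^ 2 * ζ₂ * (e - 1)) +
        -(t ^ 2 * l * (p * (e - 1) + (t * ζ * e + t ^ 2 * ζ₂ * e))) := by
      push_cast; ring
    rw [key]
    calc _ ≤ ‖p * (e - 1 + (t * R : ℝ) - (t * R : ℝ) ^ 2 / 2)‖ + ‖t * ζ * (e - 1 + (t * R : ℝ))‖ +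
        ‖t ^ 2 * ζ₂ * (e - 1)‖ + ‖t ^ 2 * l * (p * (e - 1) + (t * ζ * e + t ^ 2 * ζ₂ * e))‖ := by
          refine (norm_add_le _ _).trans (add_le_add ((norm_add_le _ _).trans
            (add_le_add ((norm_add_le _ _).trans (add_le_add ?_ ?_)) ?_)) ?_) <;> rw [norm_neg]
      _ ≤ 1 * (t * K) ^ 3 + t * K * (t * K) ^ 2 + t ^ 2 * K * (2 * (t * K)) +
          t ^ 2 * K * (2 * (t * K) + 6 * K * t) := by
          rw [norm_mul, norm_mul, norm_mul, norm_mul, norm_mul, norm_mul, norm_mul, norm_pow, hnt]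
          have := (norm_add_le (p * (e - 1)) (t * ζ * e + t ^ 2 * ζ₂ * e)).trans (add_le_add hpu hb)
          gcongr
      _ ≤ _ := by
          have : K ^ 2 * t ^ 3 ≤ K ^ 3 * t ^ 3 := by
            gcongr
            norm_num
          nlinarith

variable {d : ℕ} {Ω : Type*} [MeasurableSpace Ω] {μ : Measure Ω} [IsProbabilityMeasure μ]
  {C : Ω → Coin d} {r : CoinIdx d → Fin d → ℤ}

variable (r) in
/-- The symmetrised centred jump `(y · ρ(τ) + y · ρ(τ')) / 2` at the index `(τ, τ')`. -/
noncomputable def pairJump (y : Fin d → ℝ) (T : CoinIdx d × CoinIdx d) : ℝ :=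
  (centredJump r y T.1 + centredJump r y T.2) / 2

lemma pairJump_diag (y : Fin d → ℝ) (τ : CoinIdx d) :
    pairJump r y (τ, τ) = centredJump r y τ := by
  simp [pairJump]

lemma norm_diagVec_le (T : CoinIdx d × CoinIdx d) : ‖diagVec d T‖ ≤ 1 := by
  unfold diagVec; split_ifs <;> simp

/-- The box `[0, 2π]^d`. -/
def box (d : ℕ) : Set (Fin d → ℝ) := Set.Icc 0 fun _ => 2 * Real.pi

lemma exists_bound_on_box {ι : Type*} [Finite ι] {f : ι → (Fin d → ℝ) → ℂ}
    (hf : ∀ i, Continuous (f i)) : ∃ K, ∀ v ∈ box d, ∀ i, ‖f i v‖ ≤ K := by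
  have : Fintype ι := Fintype.ofFinite ι
  choose B hB using fun i =>
    (isCompact_Icc (a := (0 : Fin d → ℝ)) (b := fun _ => 2 * Real.pi)).exists_bound_of_continuousOn
      (hf i).continuousOn
  refine ⟨∑ i, |B i|, fun v hv i => (hB i v hv).trans ((le_abs_self _).trans ?_)⟩
  exact Finset.single_le_sum (f := fun i => |B i|) (fun i _ => abs_nonneg _) (Finset.mem_univ i)

/-- Uniformly in `v`, the tilted transfer operator has an approximate left eigenvector, close to
`∑_τ ⟨τ ⊗ τ|`, with approximate eigenvalue `1 + t² ⟨y, 𝔻(v) y⟩ / 2`. -/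
lemma exists_approx_eigenvector (hd : d ≠ 0)
    (hC : ∀ τ σ, Measurable fun ω => (C ω : Matrix (CoinIdx d) (CoinIdx d) ℂ) τ σ)
    (hS : AssumptionS μ C r) (y : Fin d → ℝ) :
    ∃ K ≥ (1 : ℝ), ∀ v ∈ box d, |quad μ C r y v / 2| ≤ K ∧ ∀ t : ℝ, 0 ≤ t → t * K ≤ 1 →
      ∃ η : CoinIdx d × CoinIdx d → ℂ, (∀ T, ‖η T - diagVec d T‖ ≤ 8 * K * t) ∧
        ∀ T, ‖((fun S => η S * Complex.exp ((t * pairJump r y S : ℝ) : ℂ)) ᵥ*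
          avgM μ C r (-v) v) T - ((1 + t ^ 2 * (quad μ C r y v / 2) : ℝ) : ℂ) * η T‖
            ≤ 12 * K ^ 3 * t ^ 3 := by
  have hd' : (d : ℂ) ≠ 0 := by simpa using hd
  set ψ := diagVec d
  set R : CoinIdx d × CoinIdx d → ℝ := pairJump r y
  let l : (Fin d → ℝ) → ℝ := fun v => quad μ C r y v / 2
  -- The ansatz is `η = (ψ + t ζ + t² ζ₂) exp (-t R)`, so that the tilt cancels in `η exp (t R)`.
  -- Comparing powers of `t` in `η exp (t R) 𝓜 = (1 + t² l) η` gives `ζ (𝓜 - 1) = x` and `ζ₂ (𝓜 - 1)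
  -- = x₂`, which `resolv` solves when the right-hand sides are annihilated by `P`.
  let x : CoinIdx d × CoinIdx d → ℂ := fun T => -(ψ T * R T)
  let ζ : (Fin d → ℝ) → CoinIdx d × CoinIdx d → ℂ := fun v => x ᵥ* resolv μ C r v
  let x₂ : (Fin d → ℝ) → CoinIdx d × CoinIdx d → ℂ := fun v T =>
    l v * ψ T - (ζ v T * R T - 1 / 2 * (ψ T * (R T) ^ 2))
  let ζ₂ : (Fin d → ℝ) → CoinIdx d × CoinIdx d → ℂ := fun v => x₂ v ᵥ* resolv μ C r v
  have hG : ∀ S T, Continuous fun v => resolv μ C r v S T := fun S T =>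
    (contDiff_resolv hd hC hS (n := 0) S T).continuous
  have hl : Continuous l := by
    have := (contDiff_quad hd hC hS (n := 0)).continuous
    exact (this.comp (f := fun v : Fin d → ℝ => (y, v)) (by fun_prop)).div_const 2
  have hζ : ∀ T, Continuous fun v => ζ v T := fun T =>
    continuous_finsetSum _ fun S _ => continuous_const.mul (hG S T)
  have hx₂ : ∀ T, Continuous fun v => x₂ v T := fun T =>
    ((Complex.continuous_ofReal.comp hl).mul continuous_const).sub
      (((hζ T).mul continuous_const).sub continuous_const)
  have hζ₂ : ∀ T, Continuous fun v => ζ₂ v T := fun T =>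
    continuous_finsetSum _ fun S _ => (hx₂ S).mul (hG S T)
  obtain ⟨K₁, hK₁⟩ := exists_bound_on_box hζ
  obtain ⟨K₂, hK₂⟩ := exists_bound_on_box hζ₂
  obtain ⟨K₃, hK₃⟩ := exists_bound_on_box (ι := Unit) fun _ => Complex.continuous_ofReal.comp hl
  obtain ⟨K₄, hK₄⟩ := exists_bound_on_box (d := d) (f := fun T _ => ((R T : ℝ) : ℂ))
    fun _ => continuous_const
  have hψx : ∑ τ, x (τ, τ) = 0 := by
    have : ∀ τ, x (τ, τ) = ((-centredJump r y τ : ℝ) : ℂ) := by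
      intro τ; simp [x, ψ, R, diagVec, pairJump_diag]
    simp only [this]
    rw [← Complex.ofReal_sum, Finset.sum_neg_distrib, sum_centredJump hd, neg_zero,
      Complex.ofReal_zero]
  -- Solvability at second order is the condition that determines `l` as half the diffusion form.
  have hψx₂ : ∀ v, ∑ τ, x₂ v (τ, τ) = 0 := by
    intro v
    have hζd : ∀ τ, ζ v (τ, τ) = ((-∑ σ, centredJump r y σ *
        (resolv μ C r v (σ, σ) (τ, τ)).re : ℝ) : ℂ) := by
      intro τ
      have : ζ v (τ, τ) = ∑ S, diagVec d S * (-(R S) * resolv μ C r v S (τ, τ)) := by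
        simp only [ζ, vecMul, dotProduct, x, ψ]
        exact Finset.sum_congr rfl fun S _ => by ring
      rw [this, sum_diagVec_mul]
      push_cast
      rw [← Finset.sum_neg_distrib]
      refine Finset.sum_congr rfl fun σ _ => ?_
      rw [resolv_diag_im]
      simp [R, pairJump_diag]
    have : ∀ τ, x₂ v (τ, τ) = ((l v + ((∑ σ, centredJump r y σ *
        (resolv μ C r v (σ, σ) (τ, τ)).re) * centredJump r y τ +
          1 / 2 * centredJump r y τ ^ 2) : ℝ) : ℂ) := by
      intro τ
      simp only [x₂, hζd]
      simp only [ψ, diagVec, R, pairJump_diag, if_true]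
      push_cast
      ring
    simp only [this]
    rw [← Complex.ofReal_sum, Finset.sum_add_distrib, Finset.sum_add_distrib, Finset.sum_const,
      Finset.card_univ, card_coinIdx, nsmul_eq_mul]
    simp only [l, quad_eq hd]
    rw [Complex.ofReal_eq_zero]
    have e : ∑ τ, (∑ σ, centredJump r y σ * (resolv μ C r v (σ, σ) (τ, τ)).re) *
        centredJump r y τ = ∑ τ, ∑ τ', centredJump r y τ * centredJump r y τ' *
          (resolv μ C r v (τ, τ) (τ', τ')).re := by
      rw [Finset.sum_comm]
      refine Finset.sum_congr rfl fun τ _ => ?_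
      rw [Finset.sum_mul]
      exact Finset.sum_congr rfl fun τ' _ => by ring
    rw [e, ← Finset.mul_sum]
    have hd'' : (d : ℝ) ≠ 0 := by simpa using hd
    push_cast
    field_simp
    ring
  let K := max 1 (max (max K₁ K₂) (max K₃ K₄))
  have hKK : 1 ≤ K ∧ K₁ ≤ K ∧ K₂ ≤ K ∧ K₃ ≤ K ∧ K₄ ≤ K := by simp [K]
  obtain ⟨hK, h1, h2, h3, h4⟩ := hKK
  have hlK : ∀ v ∈ box d, |l v| ≤ K := fun v hv => by
    have := (hK₃ v hv ()).trans h3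
    simpa [Complex.norm_real] using this
  refine ⟨K, hK, fun v hv => ⟨hlK v hv, fun t ht htK => ?_⟩⟩
  have ht1 : t ≤ 1 := by nlinarith
  have hRK : ∀ T, |R T| ≤ K := fun T => by
    have := (hK₄ v hv T).trans h4
    simpa [Complex.norm_real] using this
  have key := fun T => norm_perturbation_le ht ht1 hK htK (hRK T) (hlK v hv)
    (norm_diagVec_le T) ((hK₁ v hv T).trans h1) ((hK₂ v hv T).trans h2)
  refine ⟨fun T => (ψ T + t * ζ v T + t ^ 2 * ζ₂ v T) * Complex.exp (-(t * R T : ℝ)),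
    fun T => (key T).1, fun T => ?_⟩
  have hvec : (fun S => (ψ S + t * ζ v S + t ^ 2 * ζ₂ v S) * Complex.exp (-(t * R S : ℝ)) *
      Complex.exp ((t * R S : ℝ) : ℂ)) = ψ + (t : ℂ) • ζ v + ((t : ℂ) ^ 2) • ζ₂ v := by
    ext S
    rw [mul_assoc, ← Complex.exp_add, neg_add_cancel, Complex.exp_zero, mul_one]
    rfl
  rw [hvec, add_vecMul, add_vecMul, smul_vecMul, smul_vecMul, diagVec_vecMul_avgM hC,
    vecMul_resolv_vecMul_avgM hd hC hS v x hψx,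
    vecMul_resolv_vecMul_avgM hd hC hS v (x₂ v) (hψx₂ v)]
  refine le_of_eq_of_le ?_ (key T).2
  congr 2

end RandomQW

/-! ### The chain on the coin space, finite propagation and crude bounds. -/

namespace RandomQW

variable {d : ℕ} {Ω : Type*} [MeasurableSpace Ω]

/-- The coin state driven by the coin matrices `Cs` followed by multiplication with the diagonal
matrix `B`. -/
noncomputable def chain (B : CoinIdx d → ℂ) (φ₀ : CoinIdx d → ℂ) (Cs : ℕ → Coin d) :
    ℕ → CoinIdx d → ℂ
  | 0 => φ₀
  | n + 1 => fun τ => B τ * ((Cs n : Matrix (CoinIdx d) (CoinIdx d) ℂ) *ᵥ chain B φ₀ Cs n) τ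

lemma chain_congr (B φ₀ : CoinIdx d → ℂ) {Cs Cs' : ℕ → Coin d} (n : ℕ)
    (h : ∀ j < n, Cs j = Cs' j) : chain B φ₀ Cs n = chain B φ₀ Cs' n := by
  induction n with
  | zero => rfl
  | succ n ih =>
    simp only [chain]
    rw [h n n.lt_succ_self, ih fun j hj => h j (hj.trans n.lt_succ_self)]

lemma measurable_chain {X : Type*} [MeasurableSpace X] {B : X → CoinIdx d → ℂ}
    (hB : ∀ τ, Measurable fun x => B x τ) (φ₀ : CoinIdx d → ℂ) {Cs : X → ℕ → Coin d} (n : ℕ)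
    (hCs : ∀ j < n, ∀ τ σ,
      Measurable fun x => (Cs x j : Matrix (CoinIdx d) (CoinIdx d) ℂ) τ σ) (τ : CoinIdx d) :
    Measurable fun x => chain (B x) φ₀ (Cs x) n τ := by
  induction n generalizing τ with
  | zero => exact measurable_const
  | succ n ih =>
    simp only [chain, mulVec, dotProduct]
    refine (hB τ).mul (Finset.measurable_fun_sum _ fun σ _ => ?_)
    exact (hCs n n.lt_succ_self τ σ).mul (ih (fun j hj => hCs j (hj.trans n.lt_succ_self)) σ)

lemma norm_coin_mulVec_le (U : Coin d) {f : CoinIdx d → ℂ} {b : ℝ} (hf : ∀ τ, ‖f τ‖ ≤ b)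
    (τ : CoinIdx d) :
    ‖((U : Matrix (CoinIdx d) (CoinIdx d) ℂ) *ᵥ f) τ‖ ≤ (2 * d) * b := by
  calc _ ≤ ∑ σ, ‖(U : Matrix (CoinIdx d) (CoinIdx d) ℂ) τ σ * f σ‖ := norm_sum_le _ _
    _ ≤ ∑ _σ : CoinIdx d, b := by
      refine Finset.sum_le_sum fun σ _ => ?_
      rw [norm_mul]
      calc _ ≤ 1 * b := mul_le_mul (norm_coin_le U τ σ) (hf σ) (norm_nonneg _) zero_le_one
        _ = b := one_mul b
    _ = _ := by rw [Finset.sum_const, Finset.card_univ, card_coinIdx, nsmul_eq_mul]; push_cast; rfl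

lemma norm_chain_le {B φ₀ : CoinIdx d → ℂ} {K b : ℝ} (hK : 0 ≤ K) (hB : ∀ τ, ‖B τ‖ ≤ K)
    (hφ₀ : ∀ τ, ‖φ₀ τ‖ ≤ b) (Cs : ℕ → Coin d) (n : ℕ) (τ : CoinIdx d) :
    ‖chain B φ₀ Cs n τ‖ ≤ (K * (2 * d)) ^ n * b := by
  induction n generalizing τ with
  | zero => simpa [chain] using hφ₀ τ
  | succ n ih =>
    simp only [chain, norm_mul]
    calc _ ≤ K * ((2 * d) * ((K * (2 * d)) ^ n * b)) :=
          mul_le_mul (hB τ) (norm_coin_mulVec_le _ ih τ) (norm_nonneg _) hK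
      _ = _ := by ring

/-- The sites which can be reached in `n` steps. -/
noncomputable def reach (r : CoinIdx d → Fin d → ℤ) : ℕ → Finset (Fin d → ℤ)
  | 0 => {0}
  | n + 1 => (reach r n).biUnion fun x => Finset.univ.image fun τ => x + r τ

lemma state_eq_zero (r : CoinIdx d → Fin d → ℤ) (φ₀ : CoinIdx d → ℂ) (Cs : ℕ → Coin d) (n : ℕ)
    (x : Fin d → ℤ) (hx : x ∉ reach r n) : state r φ₀ Cs n x = 0 := by
  induction n generalizing x with
  | zero =>
    have : x ≠ 0 := by simpa [reach] using hx
    ext τ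
    simp [state, this]
  | succ n ih =>
    ext τ
    have : x - r τ ∉ reach r n := fun h => hx <| by
      simp only [reach, Finset.mem_biUnion, Finset.mem_image, Finset.mem_univ, true_and]
      exact ⟨_, h, τ, sub_add_cancel _ _⟩
    simp [state, step, ih _ this]

lemma measurable_state {X : Type*} [MeasurableSpace X] (r : CoinIdx d → Fin d → ℤ)
    (φ₀ : CoinIdx d → ℂ) {Cs : X → ℕ → Coin d} (hCs : ∀ j τ σ,
      Measurable fun x => (Cs x j : Matrix (CoinIdx d) (CoinIdx d) ℂ) τ σ) (n : ℕ)
    (k : Fin d → ℤ) (τ : CoinIdx d) : Measurable fun x => state r φ₀ (Cs x) n k τ := by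
  induction n generalizing k τ with
  | zero => exact measurable_const
  | succ n ih =>
    simp only [state, step, mulVec, dotProduct]
    exact Finset.measurable_fun_sum _ fun σ _ => (hCs n τ σ).mul (ih _ σ)

lemma norm_state_le (r : CoinIdx d → Fin d → ℤ) {φ₀ : CoinIdx d → ℂ} {b : ℝ} (hb : 0 ≤ b)
    (hφ₀ : ∀ τ, ‖φ₀ τ‖ ≤ b) (Cs : ℕ → Coin d) (n : ℕ) (k : Fin d → ℤ) (τ : CoinIdx d) :
    ‖state r φ₀ Cs n k τ‖ ≤ (2 * d) ^ n * b := by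
  induction n generalizing k τ with
  | zero =>
    simp only [state, pow_zero, one_mul]
    split_ifs
    · exact hφ₀ τ
    · simpa using hb
  | succ n ih =>
    calc _ ≤ (2 * d) * ((2 * d) ^ n * b) := norm_coin_mulVec_le _ (ih _) τ
      _ = _ := by ring

/-! ### Fourier transform of the wave function -/

/-- The exponential weight `exp (t y · (x - n r̄) / 2 - i v · x)`. -/
noncomputable def weight (r : CoinIdx d → Fin d → ℤ) (y : Fin d → ℝ) (t : ℝ) (v : Fin d → ℝ)
    (n : ℕ) (x : Fin d → ℤ) : ℂ :=
  Complex.exp ((t * (y ⬝ᵥ fun i => (x i : ℝ) - n * meanJump r i) / 2 : ℝ) -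
    Complex.I * (v ⬝ᵥ fun i => (x i : ℝ) : ℝ))

/-- The weight of a single jump. -/
noncomputable def jumpWeight (r : CoinIdx d → Fin d → ℤ) (y : Fin d → ℝ) (t : ℝ)
    (v : Fin d → ℝ) (τ : CoinIdx d) : ℂ :=
  Complex.exp ((t * centredJump r y τ / 2 : ℝ) - Complex.I * (v ⬝ᵥ fun i => (r τ i : ℝ) : ℝ))

lemma weight_succ (r : CoinIdx d → Fin d → ℤ) (y : Fin d → ℝ) (t : ℝ) (v : Fin d → ℝ) (n : ℕ)
    (x : Fin d → ℤ) (τ : CoinIdx d) :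
    weight r y t v (n + 1) (x + r τ) = jumpWeight r y t v τ * weight r y t v n x := by
  rw [weight, weight, jumpWeight, ← Complex.exp_add]
  congr 1
  have h1 : (y ⬝ᵥ fun i => (((x + r τ) i : ℤ) : ℝ) - (n + 1 : ℕ) * meanJump r i) =
      centredJump r y τ + y ⬝ᵥ fun i => (x i : ℝ) - n * meanJump r i := by
    rw [centredJump, ← dotProduct_add]
    congr 1
    ext i
    simp only [Pi.add_apply]
    push_cast
    ring
  have h2 : (v ⬝ᵥ fun i => (((x + r τ) i : ℤ) : ℝ)) =
      (v ⬝ᵥ fun i => (r τ i : ℝ)) + v ⬝ᵥ fun i => (x i : ℝ) := by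
    rw [← dotProduct_add]
    congr 1
    ext i
    simp only [Pi.add_apply]
    push_cast
    ring
  rw [h1, h2]
  push_cast
  ring

/-- The weight is multiplicative along jumps, so the conditional shift becomes multiplication by the
diagonal `jumpWeight`. Only half of the tilt is put in, as the norm will be squared. -/
lemma chain_eq_tsum (r : CoinIdx d → Fin d → ℤ) (y : Fin d → ℝ) (t : ℝ) (v : Fin d → ℝ)
    (φ₀ : CoinIdx d → ℂ) (Cs : ℕ → Coin d) (n : ℕ) (τ : CoinIdx d) :
    chain (jumpWeight r y t v) φ₀ Cs n τ =
      ∑' x, weight r y t v n x * state r φ₀ Cs n x τ := by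
  induction n generalizing τ with
  | zero =>
    rw [tsum_eq_single 0]
    · simp [chain, state, weight, dotProduct]
    · intro x hx
      simp [state, hx]
  | succ n ih =>
    have hsum : ∀ σ, Summable fun x =>
        (Cs n : Matrix (CoinIdx d) (CoinIdx d) ℂ) τ σ *
          (weight r y t v n x * state r φ₀ Cs n x σ) := fun σ =>
      summable_of_ne_finset_zero (s := reach r n) fun x hx => by
        simp [state_eq_zero r φ₀ Cs n x hx]
    rw [← (Equiv.addRight (r τ)).tsum_eq]
    simp only [Equiv.coe_addRight, weight_succ, state, step, add_sub_cancel_right, chain, mul_assoc]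
    rw [tsum_mul_left]
    congr 1
    simp only [mulVec, dotProduct, ih, Finset.mul_sum]
    simp only [← tsum_mul_left]
    rw [← Summable.tsum_finsetSum fun σ _ => hsum σ]
    exact tsum_congr fun x => Finset.sum_congr rfl fun σ _ => by ring

/-- The uniform probability measure on `(0, 2π]^d`. -/
noncomputable def torusMeasure (d : ℕ) : Measure (Fin d → ℝ) :=
  Measure.pi fun _ => ENNReal.ofReal (2 * Real.pi)⁻¹ • volume.restrict (Set.Ioc 0 (2 * Real.pi))

instance : IsProbabilityMeasure
    (ENNReal.ofReal (2 * Real.pi)⁻¹ • volume.restrict (Set.Ioc 0 (2 * Real.pi)) : Measure ℝ) :=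
  ⟨by
    have := Real.two_pi_pos
    rw [Measure.smul_apply, Measure.restrict_apply_univ, Real.volume_Ioc, smul_eq_mul, sub_zero,
      ← ENNReal.ofReal_mul (by positivity), inv_mul_cancel₀ this.ne', ENNReal.ofReal_one]⟩

instance (d : ℕ) : IsProbabilityMeasure (torusMeasure d) := by
  unfold torusMeasure; infer_instance

lemma integral_exp_int (k : ℤ) :
    ∫ x : ℝ, Complex.exp (-(Complex.I * (x * k : ℝ)))
      ∂(ENNReal.ofReal (2 * Real.pi)⁻¹ • volume.restrict (Set.Ioc 0 (2 * Real.pi)) : Measure ℝ)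
      = if k = 0 then 1 else 0 := by
  split_ifs with hk
  · simp only [hk, Int.cast_zero, mul_zero, Complex.ofReal_zero, neg_zero, Complex.exp_zero,
      integral_const, probReal_univ, one_smul]
  · rw [integral_smul_measure, ← intervalIntegral.integral_of_le Real.two_pi_pos.le]
    have hc : (-(Complex.I * k) : ℂ) ≠ 0 := by simp [hk]
    have e : ∀ x : ℝ, Complex.exp (-(Complex.I * (x * k : ℝ))) =
        Complex.exp (-(Complex.I * k) * x) := fun x => by congr 1; push_cast; ring
    simp only [e]
    rw [integral_exp_mul_complex hc]
    have : Complex.exp (-(Complex.I * k) * ((2 * Real.pi : ℝ) : ℂ)) = 1 := by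
      rw [Complex.exp_eq_one_iff]
      exact ⟨-k, by push_cast; ring⟩
    rw [this]
    simp

lemma integral_exp_torus (k : Fin d → ℤ) :
    ∫ v, Complex.exp (-(Complex.I * (v ⬝ᵥ fun i => (k i : ℝ) : ℝ))) ∂(torusMeasure d)
      = if k = 0 then 1 else 0 := by
  have e : ∀ v : Fin d → ℝ, Complex.exp (-(Complex.I * (v ⬝ᵥ fun i => (k i : ℝ) : ℝ))) =
      ∏ i, Complex.exp (-(Complex.I * (v i * k i : ℝ))) := by
    intro v
    rw [← Complex.exp_sum, dotProduct, Complex.ofReal_sum, Finset.mul_sum, Finset.sum_neg_distrib]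
  simp only [e, torusMeasure]
  rw [integral_fintype_prod_eq_prod (fun i x => Complex.exp (-(Complex.I * (x * k i : ℝ))))]
  simp only [integral_exp_int]
  by_cases hk : k = 0
  · simp [hk]
  · obtain ⟨i, hi⟩ := Function.ne_iff.1 hk
    rw [if_neg hk]
    exact Finset.prod_eq_zero (Finset.mem_univ i) (if_neg hi)

lemma continuous_weight (r : CoinIdx d → Fin d → ℤ) (y : Fin d → ℝ) (t : ℝ) (n : ℕ)
    (x : Fin d → ℤ) : Continuous fun v => weight r y t v n x := by
  unfold weight dotProduct
  fun_prop

lemma norm_weight (r : CoinIdx d → Fin d → ℤ) (y : Fin d → ℝ) (t : ℝ) (v : Fin d → ℝ) (n : ℕ)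
    (x : Fin d → ℤ) : ‖weight r y t v n x‖ =
      Real.exp (t * (y ⬝ᵥ fun i => (x i : ℝ) - n * meanJump r i) / 2) := by
  rw [weight, Complex.norm_exp]
  simp

/-- All dependence on `v` is isolated in one character, ready for orthogonality on the torus. -/
lemma weight_mul_conj (r : CoinIdx d → Fin d → ℤ) (y : Fin d → ℝ) (t : ℝ) (v : Fin d → ℝ) (n : ℕ)
    (x x' : Fin d → ℤ) : weight r y t v n x * star (weight r y t v n x') =
      weight r y t 0 n x * star (weight r y t 0 n x') *
        Complex.exp (-(Complex.I * (v ⬝ᵥ fun i => ((x - x') i : ℝ) : ℝ))) := by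
  simp only [weight, Complex.star_def, ← Complex.exp_conj, ← Complex.exp_add]
  congr 1
  simp only [map_sub, map_mul, Complex.conj_I, Complex.conj_ofReal, zero_dotProduct, Pi.sub_apply,
    Int.cast_sub]
  have : (v ⬝ᵥ fun i => (x i : ℝ) - (x' i : ℝ)) =
      (v ⬝ᵥ fun i => (x i : ℝ)) - v ⬝ᵥ fun i => (x' i : ℝ) := by
    rw [← dotProduct_sub]; rfl
  rw [this]
  push_cast
  ring

/-- Plancherel's identity for finitely supported weighted families. -/
lemma integral_norm_sq_sum_weight (r : CoinIdx d → Fin d → ℤ) (y : Fin d → ℝ) (t : ℝ) (n : ℕ)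
    (s : Finset (Fin d → ℤ)) (c : (Fin d → ℤ) → ℂ) :
    ∫ v, ‖∑ x ∈ s, weight r y t v n x * c x‖ ^ 2 ∂(torusMeasure d) =
      ∑ x ∈ s, Real.exp (t * (y ⬝ᵥ fun i => (x i : ℝ) - n * meanJump r i)) * ‖c x‖ ^ 2 := by
  have e1 : ∀ v, ((‖∑ x ∈ s, weight r y t v n x * c x‖ ^ 2 : ℝ) : ℂ) =
      ∑ x ∈ s, ∑ x' ∈ s, (weight r y t 0 n x * star (weight r y t 0 n x') * (c x * star (c x'))) *
        Complex.exp (-(Complex.I * (v ⬝ᵥ fun i => ((x - x') i : ℝ) : ℝ))) := by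
    intro v
    rw [Complex.ofReal_pow, ← Complex.mul_conj', ← Complex.star_def, star_sum, Finset.sum_mul_sum]
    refine Finset.sum_congr rfl fun x _ => Finset.sum_congr rfl fun x' _ => ?_
    rw [star_mul', mul_mul_mul_comm, weight_mul_conj]
    ring
  have hint : ∀ x x' : Fin d → ℤ, Integrable (fun v =>
      (weight r y t 0 n x * star (weight r y t 0 n x') * (c x * star (c x'))) *
        Complex.exp (-(Complex.I * (v ⬝ᵥ fun i => ((x - x') i : ℝ) : ℝ)))) (torusMeasure d) := by
    intro x x'
    refine (integrable_of_forall_norm_le ?_ 1 fun v => ?_).const_mul _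
    · refine Continuous.measurable ?_
      unfold dotProduct
      fun_prop
    · rw [Complex.norm_exp]; simp
  rw [← Complex.ofReal_inj, ← integral_complex_ofReal]
  simp only [e1]
  rw [integral_finsetSum _ fun x _ => integrable_finsetSum _ fun x' _ => hint x x',
    Complex.ofReal_sum]
  refine Finset.sum_congr rfl fun x hx => ?_
  rw [integral_finsetSum _ fun x' _ => hint x x']
  simp only [integral_const_mul]
  have e2 : ∀ x' : Fin d → ℤ, (∫ v, Complex.exp (-(Complex.I *
      (v ⬝ᵥ fun i => ((x - x') i : ℝ) : ℝ))) ∂(torusMeasure d)) = if x = x' then 1 else 0 := by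
    intro x'
    rw [integral_exp_torus]
    simp only [sub_eq_zero]
  simp only [e2, mul_ite, mul_one, mul_zero, Finset.sum_ite_eq, hx, if_true]
  rw [Complex.star_def, Complex.mul_conj', Complex.mul_conj', norm_weight,
    Complex.ofReal_mul, Complex.ofReal_pow]
  congr 1
  rw [← Complex.ofReal_pow, ← Real.exp_nat_mul]
  congr 2
  push_cast
  ring

lemma integral_norm_sq_chain (r : CoinIdx d → Fin d → ℤ) (y : Fin d → ℝ) (t : ℝ)
    (φ₀ : CoinIdx d → ℂ) (Cs : ℕ → Coin d) (n : ℕ) :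
    ∫ v, ∑ τ, ‖chain (jumpWeight r y t v) φ₀ Cs n τ‖ ^ 2 ∂(torusMeasure d) =
      ∑ k ∈ reach r n, siteProb r φ₀ Cs n k *
        Real.exp (t * (y ⬝ᵥ fun i => (k i : ℝ) - n * meanJump r i)) := by
  have e : ∀ v τ, chain (jumpWeight r y t v) φ₀ Cs n τ =
      ∑ x ∈ reach r n, weight r y t v n x * state r φ₀ Cs n x τ := by
    intro v τ
    rw [chain_eq_tsum]
    exact tsum_eq_sum fun x hx => by simp [state_eq_zero r φ₀ Cs n x hx]
  simp only [e]
  rw [integral_finsetSum]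
  · simp only [integral_norm_sq_sum_weight]
    rw [Finset.sum_comm]
    refine Finset.sum_congr rfl fun x _ => ?_
    rw [siteProb, Finset.sum_mul]
    exact Finset.sum_congr rfl fun τ _ => mul_comm _ _
  · intro τ _
    refine Integrable.of_bound (Continuous.aestronglyMeasurable ?_) ((∑ x ∈ reach r n,
      Real.exp (t * (y ⬝ᵥ fun i => (x i : ℝ) - n * meanJump r i) / 2) *
        ‖state r φ₀ Cs n x τ‖) ^ 2) (ae_of_all _ fun v => ?_)
    · exact (continuous_finsetSum _ fun x _ =>
        (continuous_weight r y t n x).mul continuous_const).norm.pow 2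
    · rw [norm_pow, norm_norm]
      gcongr
      refine (norm_sum_le _ _).trans (Finset.sum_le_sum fun x _ => ?_)
      rw [norm_mul, norm_weight]

end RandomQW

/-! ### Averaging over the coins: the recursion for the density matrix and the moment formula. -/

namespace RandomQW

variable {d : ℕ} {Ω : Type*} [MeasurableSpace Ω] {μ : Measure Ω} [IsProbabilityMeasure μ]
  {C : Ω → Coin d} {r : CoinIdx d → Fin d → ℤ} {φ₀ : CoinIdx d → ℂ}

lemma norm_le_one_of_sum_sq_eq_one (hφ₀ : ∑ τ, ‖φ₀ τ‖ ^ 2 = 1) (τ : CoinIdx d) : ‖φ₀ τ‖ ≤ 1 := by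
  have : ‖φ₀ τ‖ ^ 2 ≤ 1 := hφ₀ ▸ Finset.single_le_sum (f := fun τ => ‖φ₀ τ‖ ^ 2)
    (fun _ _ => sq_nonneg _) (Finset.mem_univ τ)
  exact (sq_le_one_iff₀ (norm_nonneg _)).1 this

lemma measurable_coin_eval
    (hC : ∀ τ σ, Measurable fun ω => (C ω : Matrix (CoinIdx d) (CoinIdx d) ℂ) τ σ)
    (j : ℕ) (τ σ : CoinIdx d) :
    Measurable fun ω : ℕ → Ω => (C (ω j) : Matrix (CoinIdx d) (CoinIdx d) ℂ) τ σ :=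
  (hC τ σ).comp (measurable_pi_apply j)

variable (μ C) in
/-- The averaged density matrix of the chain at time `n`. -/
noncomputable def corr (B φ₀ : CoinIdx d → ℂ) (n : ℕ) (S : CoinIdx d × CoinIdx d) : ℂ :=
  ∫ ω : ℕ → Ω, chain B φ₀ (fun j => C (ω j)) n S.1 * star (chain B φ₀ (fun j => C (ω j)) n S.2)
    ∂(Measure.infinitePi fun _ : ℕ => μ)

lemma measurable_chain_mul_star
    (hC : ∀ τ σ, Measurable fun ω => (C ω : Matrix (CoinIdx d) (CoinIdx d) ℂ) τ σ)
    (B φ₀ : CoinIdx d → ℂ) (n : ℕ) (S : CoinIdx d × CoinIdx d) :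
    Measurable fun ω : ℕ → Ω => chain B φ₀ (fun j => C (ω j)) n S.1 *
      star (chain B φ₀ (fun j => C (ω j)) n S.2) :=
  have h := fun τ => measurable_chain (X := ℕ → Ω) (B := fun _ => B) (fun _ => measurable_const) φ₀
    (Cs := fun ω j => C (ω j)) n (fun j _ => measurable_coin_eval hC j) τ
  (h _).mul (continuous_star.measurable.comp (h _))

lemma exists_norm_chain_le (B φ₀ : CoinIdx d → ℂ) (n : ℕ) :
    ∃ K, 0 ≤ K ∧ ∀ (Cs : ℕ → Coin d) τ, ‖chain B φ₀ Cs n τ‖ ≤ K := by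
  have hB : ∀ τ, ‖B τ‖ ≤ ∑ τ, ‖B τ‖ := fun τ =>
    Finset.single_le_sum (f := fun τ => ‖B τ‖) (fun _ _ => norm_nonneg _) (Finset.mem_univ τ)
  have hφ : ∀ τ, ‖φ₀ τ‖ ≤ ∑ τ, ‖φ₀ τ‖ := fun τ =>
    Finset.single_le_sum (f := fun τ => ‖φ₀ τ‖) (fun _ _ => norm_nonneg _) (Finset.mem_univ τ)
  have h0 : 0 ≤ ∑ τ, ‖B τ‖ := Finset.sum_nonneg fun _ _ => norm_nonneg _
  have h1 : 0 ≤ ∑ τ, ‖φ₀ τ‖ := Finset.sum_nonneg fun _ _ => norm_nonneg _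
  exact ⟨_, by positivity, fun Cs τ => norm_chain_le h0 hB hφ Cs n τ⟩

lemma integrable_chain_mul_star
    (hC : ∀ τ σ, Measurable fun ω => (C ω : Matrix (CoinIdx d) (CoinIdx d) ℂ) τ σ)
    (B φ₀ : CoinIdx d → ℂ) (n : ℕ) (S : CoinIdx d × CoinIdx d) :
    Integrable (fun ω : ℕ → Ω => chain B φ₀ (fun j => C (ω j)) n S.1 *
      star (chain B φ₀ (fun j => C (ω j)) n S.2)) (Measure.infinitePi fun _ : ℕ => μ) := by
  obtain ⟨K, hK, h⟩ := exists_norm_chain_le B φ₀ n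
  refine integrable_of_forall_norm_le (measurable_chain_mul_star hC B φ₀ n S) (K * K) fun ω => ?_
  rw [norm_mul, norm_star]
  exact mul_le_mul (h _ _) (h _ _) (norm_nonneg _) hK

/-- The coin at time `n` is independent of the chain up to time `n`. -/
lemma integral_coin_mul_chain
    (hC : ∀ τ σ, Measurable fun ω => (C ω : Matrix (CoinIdx d) (CoinIdx d) ℂ) τ σ)
    (B φ₀ : CoinIdx d → ℂ) (n : ℕ) (S T : CoinIdx d × CoinIdx d) :
    ∫ ω : ℕ → Ω, ((C (ω n) : Matrix (CoinIdx d) (CoinIdx d) ℂ) S.1 T.1 *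
        star ((C (ω n) : Matrix (CoinIdx d) (CoinIdx d) ℂ) S.2 T.2)) *
      (chain B φ₀ (fun j => C (ω j)) n T.1 * star (chain B φ₀ (fun j => C (ω j)) n T.2))
      ∂(Measure.infinitePi fun _ : ℕ => μ) = meanTensor μ C S T * corr μ C B φ₀ n T := by
  classical
  have hind := ProbabilityTheory.iIndepFun_infinitePi (P := fun _ : ℕ => μ)
    (X := fun _ ω => ω) fun _ => measurable_id
  have hind2 := hind.indepFun_finset {n} (Finset.range n) (by simp) fun i => measurable_pi_apply i
  let f : ((i : ({n} : Finset ℕ)) → Ω) → ℂ := fun z =>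
    (C (z ⟨n, by simp⟩) : Matrix (CoinIdx d) (CoinIdx d) ℂ) S.1 T.1 *
      star ((C (z ⟨n, by simp⟩) : Matrix (CoinIdx d) (CoinIdx d) ℂ) S.2 T.2)
  -- The chain at time `n` reads only the coins `j < n`, so it factors through these coordinates;
  -- the value `1` for later coins is a dummy.
  let Cs : ((i : Finset.range n) → Ω) → ℕ → Coin d := fun z j =>
    if h : j < n then C (z ⟨j, Finset.mem_range.2 h⟩) else 1
  let g : ((i : Finset.range n) → Ω) → ℂ := fun z =>
    chain B φ₀ (Cs z) n T.1 * star (chain B φ₀ (Cs z) n T.2)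
  have hf : Measurable f := (measurable_coin_mul_star hC S T).comp (measurable_pi_apply _)
  have hch : ∀ τ, Measurable fun z => chain B φ₀ (Cs z) n τ := by
    intro τ
    refine measurable_chain (B := fun _ => B) (fun _ => measurable_const) φ₀ n
      (fun j hj τ σ => ?_) τ
    simp only [Cs, dif_pos hj]
    exact (hC τ σ).comp (measurable_pi_apply _)
  have hg : Measurable g := (hch _).mul (continuous_star.measurable.comp (hch _))
  have hfg := hind2.comp hf hg
  have hgeq : ∀ ω : ℕ → Ω, g (fun i : Finset.range n => ω i) =
      chain B φ₀ (fun j => C (ω j)) n T.1 * star (chain B φ₀ (fun j => C (ω j)) n T.2) := by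
    intro ω
    have : chain B φ₀ (Cs fun i : Finset.range n => ω i) n = chain B φ₀ (fun j => C (ω j)) n :=
      chain_congr B φ₀ n fun j hj => by simp [Cs, hj]
    simp only [g, this]
  have h := hfg.integral_fun_mul_eq_mul_integral
    (hf.comp (by fun_prop)).aestronglyMeasurable (hg.comp (by fun_prop)).aestronglyMeasurable
  simp only [Function.comp_def, hgeq] at h
  refine h.trans ?_
  congr 1
  change ∫ ω : ℕ → Ω, (fun a => (C a : Matrix (CoinIdx d) (CoinIdx d) ℂ) S.1 T.1 *
        star ((C a : Matrix (CoinIdx d) (CoinIdx d) ℂ) S.2 T.2)) (ω n)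
        ∂(Measure.infinitePi fun _ : ℕ => μ) = _
  rw [← integral_map (φ := fun ω : ℕ → Ω => ω n) (measurable_pi_apply n).aemeasurable
      (measurable_coin_mul_star hC S T).aestronglyMeasurable]
  rw [Measure.infinitePi_map_eval (fun _ : ℕ => μ) n]
  rfl

lemma corr_succ
    (hC : ∀ τ σ, Measurable fun ω => (C ω : Matrix (CoinIdx d) (CoinIdx d) ℂ) τ σ)
    (B φ₀ : CoinIdx d → ℂ) (n : ℕ) (S : CoinIdx d × CoinIdx d) :
    corr μ C B φ₀ (n + 1) S =
      B S.1 * star (B S.2) * (meanTensor μ C *ᵥ corr μ C B φ₀ n) S := by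
  have e : ∀ ω : ℕ → Ω, chain B φ₀ (fun j => C (ω j)) (n + 1) S.1 *
      star (chain B φ₀ (fun j => C (ω j)) (n + 1) S.2) = B S.1 * star (B S.2) *
      ∑ T : CoinIdx d × CoinIdx d, ((C (ω n) : Matrix (CoinIdx d) (CoinIdx d) ℂ) S.1 T.1 *
        star ((C (ω n) : Matrix (CoinIdx d) (CoinIdx d) ℂ) S.2 T.2)) *
      (chain B φ₀ (fun j => C (ω j)) n T.1 * star (chain B φ₀ (fun j => C (ω j)) n T.2)) := by
    intro ω
    simp only [chain, star_mul', mulVec, dotProduct, star_sum]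
    rw [mul_mul_mul_comm, Finset.sum_mul_sum,
      Fintype.sum_prod_type (f := fun T : CoinIdx d × CoinIdx d => _)]
    congr 1
    exact Finset.sum_congr rfl fun τ _ => Finset.sum_congr rfl fun σ _ => by ring
  have hint : ∀ T : CoinIdx d × CoinIdx d, Integrable (fun ω : ℕ → Ω =>
      ((C (ω n) : Matrix (CoinIdx d) (CoinIdx d) ℂ) S.1 T.1 *
        star ((C (ω n) : Matrix (CoinIdx d) (CoinIdx d) ℂ) S.2 T.2)) *
      (chain B φ₀ (fun j => C (ω j)) n T.1 * star (chain B φ₀ (fun j => C (ω j)) n T.2)))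
      (Measure.infinitePi fun _ : ℕ => μ) := by
    intro T
    refine (integrable_chain_mul_star hC B φ₀ n T).bdd_mul (c := 1)
      ((measurable_coin_mul_star hC S T).comp (measurable_pi_apply n)).aestronglyMeasurable
      (ae_of_all _ fun ω => ?_)
    rw [norm_mul, norm_star]
    exact mul_le_one₀ (norm_coin_le _ _ _) (norm_nonneg _) (norm_coin_le _ _ _)
  simp only [corr, e]
  rw [integral_const_mul, integral_finsetSum _ fun T _ => hint T]
  simp only [integral_coin_mul_chain hC]
  rfl

/-- The two half tilts combine to `pairJump`, and the conjugation produces exactly the phase at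
`(-v, v)`. -/
lemma jumpWeight_mul_star (y : Fin d → ℝ) (t : ℝ) (v : Fin d → ℝ) (S : CoinIdx d × CoinIdx d) :
    jumpWeight r y t v S.1 * star (jumpWeight r y t v S.2) =
      Complex.exp ((t * pairJump r y S : ℝ) : ℂ) * Complex.exp (Complex.I *
      (((-v ⬝ᵥ fun i => (r S.1 i : ℝ)) + (v ⬝ᵥ fun i => (r S.2 i : ℝ)) : ℝ) : ℂ)) := by
  simp only [jumpWeight, pairJump, Complex.star_def, ← Complex.exp_conj, ← Complex.exp_add]
  congr 1
  simp only [map_sub, map_mul, Complex.conj_I, Complex.conj_ofReal, neg_dotProduct]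
  push_cast
  ring

lemma corr_jumpWeight_succ
    (hC : ∀ τ σ, Measurable fun ω => (C ω : Matrix (CoinIdx d) (CoinIdx d) ℂ) τ σ)
    (y : Fin d → ℝ) (t : ℝ) (v : Fin d → ℝ) (n : ℕ) (S : CoinIdx d × CoinIdx d) :
    corr μ C (jumpWeight r y t v) φ₀ (n + 1) S = Complex.exp ((t * pairJump r y S : ℝ) : ℂ) *
      (avgM μ C r (-v) v *ᵥ corr μ C (jumpWeight r y t v) φ₀ n) S := by
  rw [corr_succ hC, jumpWeight_mul_star, avgM, ← mulVec_mulVec, phase, mulVec_diagonal, mul_assoc]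

variable (μ C r) in
/-- The averaged squared norm of the Fourier transform of the tilted wave function. -/
noncomputable def tiltedNorm (φ₀ : CoinIdx d → ℂ) (y : Fin d → ℝ) (t : ℝ) (n : ℕ)
    (v : Fin d → ℝ) : ℝ :=
  ∫ ω : ℕ → Ω, ∑ τ, ‖chain (jumpWeight r y t v) φ₀ (fun j => C (ω j)) n τ‖ ^ 2
    ∂(Measure.infinitePi fun _ : ℕ => μ)

lemma integrable_norm_sq_chain
    (hC : ∀ τ σ, Measurable fun ω => (C ω : Matrix (CoinIdx d) (CoinIdx d) ℂ) τ σ)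
    (B φ₀ : CoinIdx d → ℂ) (n : ℕ) (τ : CoinIdx d) :
    Integrable (fun ω : ℕ → Ω => ‖chain B φ₀ (fun j => C (ω j)) n τ‖ ^ 2)
      (Measure.infinitePi fun _ : ℕ => μ) := by
  refine (integrable_chain_mul_star hC B φ₀ n (τ, τ)).norm.congr (ae_of_all _ fun ω => ?_)
  simp [pow_two]

/-- Positivity of the density matrix enters here: the trace dominates every entry, by the
arithmetic-geometric mean inequality under the integral. -/
lemma norm_corr_le
    (hC : ∀ τ σ, Measurable fun ω => (C ω : Matrix (CoinIdx d) (CoinIdx d) ℂ) τ σ)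
    (y : Fin d → ℝ) (t : ℝ) (v : Fin d → ℝ) (n : ℕ) (S : CoinIdx d × CoinIdx d) :
    ‖corr μ C (jumpWeight r y t v) φ₀ n S‖ ≤ tiltedNorm μ C r φ₀ y t n v := by
  refine (norm_integral_le_integral_norm _).trans (integral_mono
    (integrable_chain_mul_star hC _ φ₀ n S).norm
    (integrable_finsetSum _ fun τ _ => integrable_norm_sq_chain hC _ φ₀ n τ) fun ω => ?_)
  set f := fun τ => chain (jumpWeight r y t v) φ₀ (fun j => C (ω j)) n τ
  have h : ∀ τ, ‖f τ‖ ^ 2 ≤ ∑ τ, ‖f τ‖ ^ 2 := fun τ => Finset.single_le_sum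
    (f := fun τ => ‖f τ‖ ^ 2) (fun _ _ => sq_nonneg _) (Finset.mem_univ τ)
  have h1 := h S.1
  have h2 := h S.2
  change ‖f S.1 * star (f S.2)‖ ≤ ∑ τ, ‖f τ‖ ^ 2
  rw [norm_mul, norm_star]
  nlinarith [sq_nonneg (‖f S.1‖ - ‖f S.2‖)]

lemma sum_corr_diag
    (hC : ∀ τ σ, Measurable fun ω => (C ω : Matrix (CoinIdx d) (CoinIdx d) ℂ) τ σ)
    (y : Fin d → ℝ) (t : ℝ) (v : Fin d → ℝ) (n : ℕ) :
    ∑ τ, corr μ C (jumpWeight r y t v) φ₀ n (τ, τ) = tiltedNorm μ C r φ₀ y t n v := by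
  rw [tiltedNorm, integral_finsetSum _ fun τ _ => integrable_norm_sq_chain hC _ φ₀ n τ,
    Complex.ofReal_sum]
  refine Finset.sum_congr rfl fun τ _ => ?_
  rw [← integral_complex_ofReal, corr]
  congr 1
  ext ω
  rw [Complex.star_def, Complex.mul_conj', Complex.ofReal_pow]

omit [IsProbabilityMeasure μ] in
lemma tiltedNorm_nonneg (y : Fin d → ℝ) (t : ℝ) (n : ℕ) (v : Fin d → ℝ) :
    0 ≤ tiltedNorm μ C r φ₀ y t n v :=
  integral_nonneg fun _ => Finset.sum_nonneg fun _ _ => sq_nonneg _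

lemma tiltedNorm_zero (hφ₀ : ∑ τ, ‖φ₀ τ‖ ^ 2 = 1) (y : Fin d → ℝ) (t : ℝ) (v : Fin d → ℝ) :
    tiltedNorm μ C r φ₀ y t 0 v = 1 := by
  simp only [tiltedNorm, chain, hφ₀, integral_const, probReal_univ, one_smul]

lemma measurable_jumpWeight (y : Fin d → ℝ) (t : ℝ) (τ : CoinIdx d) :
    Measurable fun v => jumpWeight r y t v τ := by
  refine Continuous.measurable ?_
  unfold jumpWeight dotProduct
  fun_prop

lemma norm_jumpWeight_le (y : Fin d → ℝ) (t : ℝ) (v : Fin d → ℝ) (τ : CoinIdx d) :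
    ‖jumpWeight r y t v τ‖ ≤ ∑ τ, Real.exp (t * centredJump r y τ / 2) := by
  have : ‖jumpWeight r y t v τ‖ = Real.exp (t * centredJump r y τ / 2) := by
    rw [jumpWeight, Complex.norm_exp]; simp
  rw [this]
  exact Finset.single_le_sum (f := fun τ => Real.exp (t * centredJump r y τ / 2))
    (fun _ _ => (Real.exp_pos _).le) (Finset.mem_univ τ)

lemma integrable_prod_norm_sq_chain
    (hC : ∀ τ σ, Measurable fun ω => (C ω : Matrix (CoinIdx d) (CoinIdx d) ℂ) τ σ)
    (hφ₀ : ∑ τ, ‖φ₀ τ‖ ^ 2 = 1) (y : Fin d → ℝ) (t : ℝ) (n : ℕ) :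
    Integrable (fun p : (ℕ → Ω) × (Fin d → ℝ) =>
      ∑ τ, ‖chain (jumpWeight r y t p.2) φ₀ (fun j => C (p.1 j)) n τ‖ ^ 2)
      ((Measure.infinitePi fun _ : ℕ => μ).prod (torusMeasure d)) := by
  refine integrable_finsetSum _ fun τ _ => ?_
  have h0 : 0 ≤ ∑ τ, Real.exp (t * centredJump r y τ / 2) :=
    Finset.sum_nonneg fun _ _ => (Real.exp_pos _).le
  refine Integrable.of_bound (Measurable.aestronglyMeasurable ?_)
    ((((∑ τ, Real.exp (t * centredJump r y τ / 2)) * (2 * d)) ^ n * 1) ^ 2)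
    (ae_of_all _ fun p => ?_)
  · refine (measurable_chain (X := (ℕ → Ω) × (Fin d → ℝ)) (B := fun p => jumpWeight r y t p.2)
      (fun τ => (measurable_jumpWeight y t τ).comp measurable_snd) φ₀
      (Cs := fun p j => C (p.1 j)) n (fun j _ τ σ => ?_) τ).norm.pow_const 2
    exact (measurable_coin_eval hC j τ σ).comp measurable_fst
  · rw [norm_pow, norm_norm]
    gcongr
    exact norm_chain_le h0 (norm_jumpWeight_le y t p.2) (norm_le_one_of_sum_sq_eq_one hφ₀) _ _ _

lemma integrable_tiltedNorm
    (hC : ∀ τ σ, Measurable fun ω => (C ω : Matrix (CoinIdx d) (CoinIdx d) ℂ) τ σ)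
    (hφ₀ : ∑ τ, ‖φ₀ τ‖ ^ 2 = 1) (y : Fin d → ℝ) (t : ℝ) (n : ℕ) :
    Integrable (tiltedNorm μ C r φ₀ y t n) (torusMeasure d) :=
  (integrable_prod_norm_sq_chain hC hφ₀ y t n).integral_prod_right

/-- The exponential moments of the averaged distribution in terms of the Fourier transform. -/
lemma tsum_avgProb_mul_exp
    (hC : ∀ τ σ, Measurable fun ω => (C ω : Matrix (CoinIdx d) (CoinIdx d) ℂ) τ σ)
    (hφ₀ : ∑ τ, ‖φ₀ τ‖ ^ 2 = 1) (y : Fin d → ℝ) (t : ℝ) (n : ℕ) :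
    ∑' k, avgProb μ C r φ₀ n k *
        Real.exp (t * (y ⬝ᵥ fun i => (k i : ℝ) - n * meanJump r i)) =
      ∫ v, tiltedNorm μ C r φ₀ y t n v ∂(torusMeasure d) := by
  have h1 : ∫ v, tiltedNorm μ C r φ₀ y t n v ∂(torusMeasure d) =
      ∫ ω : ℕ → Ω, ∑ k ∈ reach r n, siteProb r φ₀ (fun j => C (ω j)) n k *
        Real.exp (t * (y ⬝ᵥ fun i => (k i : ℝ) - n * meanJump r i))
        ∂(Measure.infinitePi fun _ : ℕ => μ) := by
    simp only [tiltedNorm]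
    rw [integral_integral_swap]
    · simp only [integral_norm_sq_chain]
    · exact (integrable_prod_norm_sq_chain hC hφ₀ y t n).swap
  have hsite : ∀ k, Integrable (fun ω : ℕ → Ω => siteProb r φ₀ (fun j => C (ω j)) n k)
      (Measure.infinitePi fun _ : ℕ => μ) := by
    intro k
    refine integrable_finsetSum _ fun τ _ => Integrable.of_bound
      ((measurable_state r φ₀ (Cs := fun (ω : ℕ → Ω) j => C (ω j))
        (measurable_coin_eval hC) n k τ).norm.pow_const 2).aestronglyMeasurable
      (((2 * d) ^ n * 1) ^ 2) (ae_of_all _ fun ω => ?_)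
    rw [norm_pow, norm_norm]
    gcongr
    exact norm_state_le r zero_le_one (norm_le_one_of_sum_sq_eq_one hφ₀) _ n k τ
  rw [h1, integral_finsetSum _ fun k _ => (hsite k).mul_const _]
  simp only [integral_mul_const]
  refine tsum_eq_sum fun k hk => ?_
  have : avgProb μ C r φ₀ n k = 0 := by
    simp [avgProb, siteProb, state_eq_zero r φ₀ _ n k hk]
  rw [this, zero_mul]

end RandomQW

/-! ### Exponential growth bounds, uniform in the momentum. -/

namespace RandomQW

/-- Use `log (1 + x) ≥ x / (1 + x)`; the remaining inequality is `x² (1 + 2x) ≥ 0`. -/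
lemma exp_sub_two_mul_sq_le_one_add {x : ℝ} (hx : -(1 / 2) ≤ x) :
    Real.exp (x - 2 * x ^ 2) ≤ 1 + x := by
  have h1 : 0 < 1 + x := by linarith
  rw [← Real.le_log_iff_exp_le h1]
  refine le_trans ?_ (Real.one_sub_inv_le_log_of_pos h1)
  rw [show 1 - (1 + x)⁻¹ = x / (1 + x) by field_simp; ring, le_div_iff₀ h1]
  nlinarith [mul_nonneg (sq_nonneg x) (show 0 ≤ 1 + 2 * x by linarith)]

/-- Two-sided exponential bounds for a sequence with almost constant ratio. -/
lemma exp_bounds_of_ratio_bounds {W : ℕ → ℝ} (hW : ∀ n, 0 ≤ W n) {l K L t : ℝ} (hl : |l| ≤ K)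
    (ht : 0 ≤ t) (ht1 : t ≤ 1) (hL : 0 ≤ L) (hsmall : t * (K + L) ≤ 1 / 2)
    (h : ∀ n, |W (n + 1) - (1 + t ^ 2 * l) * W n| ≤ L * t ^ 3 * W n) (n : ℕ) :
    Real.exp (n * (t ^ 2 * l - (L + 2 * (K + L) ^ 2) * t ^ 3)) * W 0 ≤ W n ∧
      W n ≤ Real.exp (n * (t ^ 2 * l + (L + 2 * (K + L) ^ 2) * t ^ 3)) * W 0 := by
  have hK : 0 ≤ K := (abs_nonneg l).trans hl
  have hl' := abs_le.1 hl
  have ht3 : 0 ≤ t ^ 3 := pow_nonneg ht 3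
  have ht32 : t ^ 3 ≤ t ^ 2 := pow_le_pow_of_le_one ht ht1 (by norm_num)
  have ht2 : t ^ 2 ≤ t := by nlinarith
  set x := t ^ 2 * l - L * t ^ 3 with hx
  have hxabs : |x| ≤ t ^ 2 * (K + L) := by
    rw [abs_le]
    constructor <;> nlinarith [mul_le_mul_of_nonneg_left hl'.1 (sq_nonneg t),
      mul_le_mul_of_nonneg_left hl'.2 (sq_nonneg t), mul_le_mul_of_nonneg_left ht32 hL,
      mul_nonneg hL ht3]
  have hxhalf : |x| ≤ 1 / 2 := hxabs.trans (le_trans (by gcongr) hsmall)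
  have hxsq : x ^ 2 ≤ (K + L) ^ 2 * t ^ 3 := by
    calc x ^ 2 = |x| ^ 2 := (sq_abs x).symm
      _ ≤ (t ^ 2 * (K + L)) ^ 2 := by gcongr
      _ = (K + L) ^ 2 * (t ^ 3 * t) := by ring
      _ ≤ (K + L) ^ 2 * (t ^ 3 * 1) := by gcongr
      _ = _ := by ring
  have hlow : Real.exp (t ^ 2 * l - (L + 2 * (K + L) ^ 2) * t ^ 3) ≤ 1 + x := by
    refine le_trans (Real.exp_le_exp.2 ?_)
      (exp_sub_two_mul_sq_le_one_add (x := x) (by linarith [(abs_le.1 hxhalf).1]))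
    rw [hx] at hxsq ⊢
    linarith
  have hup : 1 + (t ^ 2 * l + L * t ^ 3) ≤
      Real.exp (t ^ 2 * l + (L + 2 * (K + L) ^ 2) * t ^ 3) := by
    refine le_trans ?_ (Real.add_one_le_exp _)
    nlinarith [mul_nonneg (sq_nonneg (K + L)) ht3]
  induction n with
  | zero => simp
  | succ n ih =>
    have hn := abs_le.1 (h n)
    constructor
    · calc _ = Real.exp (t ^ 2 * l - (L + 2 * (K + L) ^ 2) * t ^ 3) *
            (Real.exp (n * (t ^ 2 * l - (L + 2 * (K + L) ^ 2) * t ^ 3)) * W 0) := by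
            rw [← mul_assoc, ← Real.exp_add]; congr 2; push_cast; ring
        _ ≤ (1 + x) * W n := mul_le_mul hlow ih.1 (mul_nonneg (Real.exp_pos _).le (hW 0))
            ((Real.exp_pos _).le.trans hlow)
        _ ≤ W (n + 1) := by rw [hx]; linarith [hn.1]
    · calc W (n + 1) ≤ (1 + (t ^ 2 * l + L * t ^ 3)) * W n := by linarith [hn.2]
        _ ≤ Real.exp (t ^ 2 * l + (L + 2 * (K + L) ^ 2) * t ^ 3) *
            (Real.exp (n * (t ^ 2 * l + (L + 2 * (K + L) ^ 2) * t ^ 3)) * W 0) :=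
            mul_le_mul hup ih.2 (hW n) (Real.exp_pos _).le
        _ = _ := by rw [← mul_assoc, ← Real.exp_add]; congr 2; push_cast; ring

variable {d : ℕ} {Ω : Type*} [MeasurableSpace Ω] {μ : Measure Ω} [IsProbabilityMeasure μ]
  {C : Ω → Coin d} {r : CoinIdx d → Fin d → ℤ} {φ₀ : CoinIdx d → ℂ}

lemma norm_dotProduct_corr_le
    (hC : ∀ τ σ, Measurable fun ω => (C ω : Matrix (CoinIdx d) (CoinIdx d) ℂ) τ σ)
    (y : Fin d → ℝ) (t : ℝ) (v : Fin d → ℝ) (n : ℕ) {e : CoinIdx d × CoinIdx d → ℂ} {ε : ℝ}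
    (he : ∀ T, ‖e T‖ ≤ ε) :
    ‖e ⬝ᵥ corr μ C (jumpWeight r y t v) φ₀ n‖ ≤
      (2 * d) ^ 2 * ε * tiltedNorm μ C r φ₀ y t n v := by
  calc _ ≤ ∑ T, ‖e T * corr μ C (jumpWeight r y t v) φ₀ n T‖ := norm_sum_le _ _
    _ ≤ ∑ _T : CoinIdx d × CoinIdx d, ε * tiltedNorm μ C r φ₀ y t n v := by
      refine Finset.sum_le_sum fun T _ => ?_
      rw [norm_mul]
      exact mul_le_mul (he T) (norm_corr_le hC y t v n T) (norm_nonneg _)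
        ((norm_nonneg _).trans (he T))
    _ = _ := by
      rw [Finset.sum_const, Finset.card_univ, Fintype.card_prod, card_coinIdx, nsmul_eq_mul]
      push_cast
      ring

/-- Uniform two-sided bounds for the tilted norm. -/
lemma exists_tiltedNorm_bounds (hd : d ≠ 0)
    (hC : ∀ τ σ, Measurable fun ω => (C ω : Matrix (CoinIdx d) (CoinIdx d) ℂ) τ σ)
    (hS : AssumptionS μ C r) (hφ₀ : ∑ τ, ‖φ₀ τ‖ ^ 2 = 1) (y : Fin d → ℝ) :
    ∃ K : ℝ, ∃ t₀ > 0, ∀ v ∈ box d, ∀ t, 0 ≤ t → t ≤ t₀ → ∀ n : ℕ,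
      1 / 3 * Real.exp (n * (t ^ 2 * (quad μ C r y v / 2) - K * t ^ 3)) ≤
          tiltedNorm μ C r φ₀ y t n v ∧
        tiltedNorm μ C r φ₀ y t n v ≤
          3 * Real.exp (n * (t ^ 2 * (quad μ C r y v / 2) + K * t ^ 3)) := by
  obtain ⟨K, hK, hη⟩ := exists_approx_eigenvector hd hC hS y
  set N : ℝ := (2 * d) ^ 2 with hN
  have hN0 : 0 ≤ N := sq_nonneg _
  have hK0 : 0 < K := by linarith
  -- `N` counts the entries of `η`, `12 K³` is the eigenvector error, and the extra factor `2` comes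
  -- from `h ≤ 2 W`.
  set L : ℝ := 24 * N * K ^ 3 with hL
  have hL0 : 0 ≤ L := by positivity
  have hden : 0 < 2 * (K + L) + 16 * K * N + 1 := by positivity
  -- The threshold ensures `t (K + L) ≤ 1/2` for the ratio lemma and `8 K N t ≤ 1/2`, which makes
  -- `W` comparable to the trace `h`.
  refine ⟨L + 2 * (K + L) ^ 2, 1 / (2 * (K + L) + 16 * K * N + 1), by positivity,
    fun v hv t ht htt n => ?_⟩
  rw [le_div_iff₀ hden] at htt
  obtain ⟨hl, hη⟩ := hη v hv
  have e1 : 0 ≤ t * K := by positivity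
  have e2 : 0 ≤ t * L := by positivity
  have e3 : 0 ≤ t * K * N := by positivity
  have htK : t * K ≤ 1 := by nlinarith
  obtain ⟨η, hη1, hη2⟩ := hη t ht htK
  set ρ := fun n => corr μ C (jumpWeight r y t v) φ₀ n
  set h := fun n => tiltedNorm μ C r φ₀ y t n v
  have hh0 : ∀ n, 0 ≤ h n := fun n => tiltedNorm_nonneg y t n v
  let W : ℕ → ℝ := fun n => (η ⬝ᵥ ρ n).re
  have hWh : ∀ n, |W n - h n| ≤ h n / 2 := by
    intro n
    have : W n - h n = ((η - diagVec d) ⬝ᵥ ρ n).re := by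
      have hsum : diagVec d ⬝ᵥ ρ n = (h n : ℂ) := by
        rw [dotProduct, sum_diagVec_mul, sum_corr_diag hC]
      rw [sub_dotProduct, hsum, Complex.sub_re, Complex.ofReal_re]
    rw [this]
    refine (Complex.abs_re_le_norm _).trans
      ((norm_dotProduct_corr_le hC y t v n fun T => hη1 T).trans ?_)
    have : N * (8 * K * t) ≤ 1 / 2 := by nlinarith
    calc N * (8 * K * t) * h n ≤ 1 / 2 * h n := by gcongr; exact hh0 n
      _ = _ := by ring
  have hW2 : ∀ n, h n ≤ 2 * W n ∧ W n ≤ 3 / 2 * h n := fun n => by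
    have := abs_le.1 (hWh n)
    constructor <;> linarith
  have hW0 : ∀ n, 0 ≤ W n := fun n => by linarith [hh0 n, (hW2 n).1]
  have hrec : ∀ n, |W (n + 1) - (1 + t ^ 2 * (quad μ C r y v / 2)) * W n| ≤ L * t ^ 3 * W n := by
    intro n
    set A := (fun S => η S * Complex.exp ((t * pairJump r y S : ℝ) : ℂ)) ᵥ* avgM μ C r (-v) v
    have h1 : η ⬝ᵥ ρ (n + 1) = A ⬝ᵥ ρ n := by
      rw [← dotProduct_mulVec]
      simp only [dotProduct]
      refine Finset.sum_congr rfl fun S _ => ?_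
      simp only [ρ, corr_jumpWeight_succ hC]
      ring
    have h2 : W (n + 1) - (1 + t ^ 2 * (quad μ C r y v / 2)) * W n =
        ((A - ((1 + t ^ 2 * (quad μ C r y v / 2) : ℝ) : ℂ) • η) ⬝ᵥ ρ n).re := by
      simp only [W]
      rw [h1, sub_dotProduct, smul_dotProduct, Complex.sub_re, smul_eq_mul, Complex.re_ofReal_mul]
    rw [h2]
    refine (Complex.abs_re_le_norm _).trans ((norm_dotProduct_corr_le hC y t v n
      fun T => hη2 T).trans ?_)
    calc N * (12 * K ^ 3 * t ^ 3) * h n ≤ N * (12 * K ^ 3 * t ^ 3) * (2 * W n) := by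
          gcongr
          exact (hW2 n).1
      _ = _ := by rw [hL]; ring
  obtain ⟨hlo, hhi⟩ := exp_bounds_of_ratio_bounds hW0 hl ht (by nlinarith) hL0 (by nlinarith)
    hrec n
  have h00 : h 0 = 1 := tiltedNorm_zero hφ₀ y t v
  -- From `1/2 ≤ W 0 ≤ 3/2` and `2/3 W n ≤ h n ≤ 2 W n` come the constants `1/3` and `3`.
  have hWz := hW2 0
  rw [h00] at hWz
  constructor
  · calc _ ≤ 2 / 3 * (Real.exp (n * (t ^ 2 * (quad μ C r y v / 2) -
          (L + 2 * (K + L) ^ 2) * t ^ 3)) * W 0) := by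
          nlinarith [Real.exp_pos (n * (t ^ 2 * (quad μ C r y v / 2) -
            (L + 2 * (K + L) ^ 2) * t ^ 3))]
      _ ≤ 2 / 3 * W n := by gcongr
      _ ≤ h n := by linarith [(hW2 n).2]
  · calc h n ≤ 2 * W n := (hW2 n).1
      _ ≤ 2 * (Real.exp (n * (t ^ 2 * (quad μ C r y v / 2) +
          (L + 2 * (K + L) ^ 2) * t ^ 3)) * W 0) := by gcongr
      _ ≤ _ := by
          nlinarith [Real.exp_pos (n * (t ^ 2 * (quad μ C r y v / 2) +
            (L + 2 * (K + L) ^ 2) * t ^ 3))]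

/-! ### Laplace's principle on the torus -/

lemma ae_mem_box : ∀ᵐ v ∂(torusMeasure d), v ∈ box d := by
  have h : torusMeasure d (box d) = 1 := by
    rw [box, show (0 : Fin d → ℝ) = fun _ => 0 from rfl, ← Set.pi_univ_Icc, torusMeasure,
      Measure.pi_pi]
    refine Finset.prod_eq_one fun i _ => ?_
    refine le_antisymm prob_le_one ?_
    rw [← measure_univ (μ := ENNReal.ofReal (2 * Real.pi)⁻¹ •
      volume.restrict (Set.Ioc 0 (2 * Real.pi)))]
    rw [Measure.smul_apply, Measure.smul_apply, Measure.restrict_apply_univ,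
      Measure.restrict_apply measurableSet_Icc,
      Set.inter_eq_right.2 Set.Ioc_subset_Icc_self]
  rw [ae_iff]
  exact (prob_compl_eq_zero_iff (by unfold box; exact measurableSet_Icc)).2 h

/-- `v` may lie on a lower face of the cube, so the small box is taken with `v` as its lower corner.
-/
lemma torusMeasure_pos_of_mem_nhds {v : Fin d → ℝ}
    (hv : ∀ i, v i ∈ Set.Ico 0 (2 * Real.pi)) {s : Set (Fin d → ℝ)} (hs : s ∈ 𝓝 v) :
    0 < torusMeasure d s := by
  obtain ⟨e, he, hball⟩ := Metric.mem_nhds_iff.1 hs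
  set u := fun i => Set.Ioo (v i) (min (v i + e) (2 * Real.pi))
  refine lt_of_lt_of_le ?_ (measure_mono (s := Set.pi Set.univ u) ?_)
  · rw [torusMeasure, Measure.pi_pi]
    rw [pos_iff_ne_zero, Finset.prod_ne_zero_iff]
    intro i _
    have hlt : v i < min (v i + e) (2 * Real.pi) := lt_min (by linarith) (hv i).2
    rw [Measure.smul_apply, Measure.restrict_apply measurableSet_Ioo, Set.inter_eq_left.2,
      Real.volume_Ioo, smul_eq_mul]
    · refine mul_ne_zero ?_ ?_
      · simpa using Real.pi_pos
      · simpa [ENNReal.ofReal_eq_zero, sub_nonpos] using ⟨he, (hv i).2⟩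
    · intro x hx
      exact ⟨(hv i).1.trans_lt hx.1, (hx.2.trans_le (min_le_right _ _)).le⟩
  · intro w hw
    refine hball ?_
    rw [Metric.mem_ball, dist_pi_lt_iff he]
    intro i
    have := hw i (Set.mem_univ i)
    rw [Real.dist_eq, abs_lt]
    have h2 := this.2.trans_le (min_le_left _ _)
    constructor <;> linarith [this.1]

/-- The upper bound replaces `f` by its maximum; the lower one restricts to `{f > f v₁ - δ}`, whose
positive measure is independent of `n`. Constant prefactors disappear because `a n → ∞`. -/
lemma tendsto_log_integral {f : (Fin d → ℝ) → ℝ} (hf : Continuous f) {v₁ : Fin d → ℝ}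
    (hv₁ : v₁ ∈ maxPoints f) {a ε : ℕ → ℝ} (ha : Tendsto a atTop atTop)
    (hε : Tendsto ε atTop (𝓝 0)) {c : ℝ} (hc : 0 < c) {H : ℕ → (Fin d → ℝ) → ℝ}
    (hint : ∀ n, Integrable (H n) (torusMeasure d))
    (hlow : ∀ᶠ n in atTop, ∀ v ∈ box d, c⁻¹ * Real.exp (a n * (f v - ε n)) ≤ H n v)
    (hup : ∀ᶠ n in atTop, ∀ v ∈ box d, H n v ≤ c * Real.exp (a n * (f v + ε n))) :
    Tendsto (fun n => 1 / a n * Real.log (∫ v, H n v ∂(torusMeasure d))) atTop (𝓝 (f v₁)) := by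
  have hainv : Tendsto (fun n => (a n)⁻¹) atTop (𝓝 0) := tendsto_inv_atTop_zero.comp ha
  have hapos : ∀ᶠ n in atTop, 0 < a n := ha.eventually_gt_atTop 0
  have hlower : ∀ δ > 0, ∃ b : ℝ, 0 < b ∧ ∀ᶠ n in atTop,
      b * Real.exp (a n * (f v₁ - δ - ε n)) ≤ ∫ v, H n v ∂(torusMeasure d) := by
    intro δ hδ
    set s : Set (Fin d → ℝ) := {v | f v₁ - δ < f v}
    have hs : MeasurableSet s := (isOpen_lt continuous_const hf).measurableSet
    have hspos : 0 < (torusMeasure d).real s :=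
      ENNReal.toReal_pos (torusMeasure_pos_of_mem_nhds hv₁.1
        ((isOpen_lt continuous_const hf).mem_nhds (by simp [hδ]))).ne' (measure_ne_top _ _)
    refine ⟨(torusMeasure d).real s * c⁻¹, by positivity, ?_⟩
    filter_upwards [hlow, hapos] with n hn han
    have h0 : 0 ≤ᵐ[torusMeasure d] H n := by
      filter_upwards [ae_mem_box] with v hv
      exact le_trans (by positivity) (hn v hv)
    calc _ = ∫ _v in s, c⁻¹ * Real.exp (a n * (f v₁ - δ - ε n)) ∂(torusMeasure d) := by
          rw [setIntegral_const, smul_eq_mul, mul_assoc]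
      _ ≤ ∫ v in s, H n v ∂(torusMeasure d) := by
          refine setIntegral_mono_on_ae (integrable_const _).integrableOn (hint n).integrableOn hs ?_
          filter_upwards [ae_mem_box] with v hv hvs
          refine le_trans ?_ (hn v hv)
          have : f v₁ - δ < f v := hvs
          gcongr
      _ ≤ _ := setIntegral_le_integral (hint n) h0
  have hupper : ∀ᶠ n in atTop, ∫ v, H n v ∂(torusMeasure d) ≤
      c * Real.exp (a n * (f v₁ + ε n)) := by
    filter_upwards [hup, hapos] with n hn han
    calc _ ≤ ∫ _v, c * Real.exp (a n * (f v₁ + ε n)) ∂(torusMeasure d) := by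
          refine integral_mono_ae (hint n) (integrable_const _) ?_
          filter_upwards [ae_mem_box] with v hv
          refine (hn v hv).trans ?_
          have := hv₁.2 v
          gcongr
      _ = _ := by simp only [integral_const, probReal_univ, one_smul]
  rw [tendsto_order]
  constructor
  · intro b hb
    obtain ⟨β, hβ, hβ'⟩ := hlower ((f v₁ - b) / 2) (by linarith)
    have hlim : Tendsto (fun n => (a n)⁻¹ * Real.log β + (f v₁ - (f v₁ - b) / 2 - ε n)) atTop
        (𝓝 (0 * Real.log β + (f v₁ - (f v₁ - b) / 2 - 0))) :=
      (hainv.mul_const _).add (tendsto_const_nhds.sub hε)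
    filter_upwards [hβ', hapos, hlim.eventually_const_lt (show b < _ by linarith)] with n hn han hlt
    refine hlt.trans_le ?_
    have hpos : 0 < β * Real.exp (a n * (f v₁ - (f v₁ - b) / 2 - ε n)) := by positivity
    have := Real.log_le_log hpos hn
    rw [Real.log_mul hβ.ne' (Real.exp_pos _).ne', Real.log_exp] at this
    rw [one_div]
    calc _ = (a n)⁻¹ * (Real.log β + a n * (f v₁ - (f v₁ - b) / 2 - ε n)) := by field_simp
      _ ≤ _ := by gcongr
  · intro b hb
    -- Any `δ` would do: the lower bound serves only to make the integral positive before taking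
    -- logarithms.
    obtain ⟨β, hβ, hβ'⟩ := hlower 1 one_pos
    have hlim : Tendsto (fun n => (a n)⁻¹ * Real.log c + (f v₁ + ε n)) atTop
        (𝓝 (0 * Real.log c + (f v₁ + 0))) :=
      (hainv.mul_const _).add (tendsto_const_nhds.add hε)
    filter_upwards [hβ', hupper, hapos, hlim.eventually_lt_const (show _ < b by linarith)]
      with n hn hn2 han hlt
    refine lt_of_le_of_lt ?_ hlt
    have hpos : 0 < ∫ v, H n v ∂(torusMeasure d) := lt_of_lt_of_le (by positivity) hn
    have := Real.log_le_log hpos hn2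
    rw [Real.log_mul hc.ne' (Real.exp_pos _).ne', Real.log_exp] at this
    rw [one_div]
    calc _ ≤ (a n)⁻¹ * (Real.log c + a n * (f v₁ + ε n)) := by gcongr
      _ = _ := by field_simp

/-- The scaled logarithmic generating function converges to half the maximum of the quadratic
form of the diffusion matrix over the torus. -/
theorem tendsto_logGen (hd : d ≠ 0)
    (hC : ∀ τ σ, Measurable fun ω => (C ω : Matrix (CoinIdx d) (CoinIdx d) ℂ) τ σ)
    (hφ₀ : ∑ τ, ‖φ₀ τ‖ ^ 2 = 1) (hS : AssumptionS μ C r)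
    {a : ℕ → ℝ} (ha : ∀ n, 0 < a n) (ha_top : Tendsto a atTop atTop)
    (ha_zero : Tendsto (fun n : ℕ => a n / n) atTop (𝓝 0)) (y v₁ : Fin d → ℝ)
    (hv₁ : v₁ ∈ maxPoints (quad μ C r y)) :
    Tendsto (fun n : ℕ => 1 / a n * logGen μ C r φ₀ a n (a n • y)) atTop
      (𝓝 (1 / 2 * quad μ C r y v₁)) := by
  obtain ⟨K, t₀, ht₀, hb⟩ := exists_tiltedNorm_bounds hd hC hS hφ₀ y
  -- This is the tilt per unit length, `a_n / √(n a_n)`. The error exponent is `n K t³ = a_n (K t)`,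
  -- whence the choice `ε = K t` below.
  set t : ℕ → ℝ := fun n => Real.sqrt (a n / n) with ht
  have ht0 : Tendsto t atTop (𝓝 0) := by
    have := (Real.continuous_sqrt.tendsto 0).comp ha_zero
    rwa [Real.sqrt_zero] at this
  have hqc : Continuous fun v => quad μ C r y v / 2 := by
    have := (contDiff_quad hd hC hS (n := 0)).continuous
    exact (this.comp (f := fun v : Fin d → ℝ => (y, v)) (by fun_prop)).div_const 2
  have hv₁' : v₁ ∈ maxPoints fun v => quad μ C r y v / 2 :=
    ⟨hv₁.1, fun w => by have := hv₁.2 w; linarith⟩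
  have hsq : ∀ n : ℕ, n ≠ 0 → n * t n ^ 2 = a n := by
    intro n hn
    rw [ht, Real.sq_sqrt (div_nonneg (ha n).le n.cast_nonneg)]
    field_simp
  have hev : ∀ᶠ n : ℕ in atTop, n ≠ 0 ∧ t n ≤ t₀ :=
    (eventually_ne_atTop 0).and (ht0.eventually_le_const ht₀)
  have hlim := tendsto_log_integral hqc hv₁' ha_top
    (ε := fun n => K * t n) (by simpa using ht0.const_mul K) (c := 3) (by norm_num)
    (H := fun n => tiltedNorm μ C r φ₀ y (t n) n)
    (fun n => integrable_tiltedNorm hC hφ₀ y (t n) n)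
    (by
      filter_upwards [hev] with n hn v hv
      refine le_of_eq_of_le ?_ (hb v hv (t n) (Real.sqrt_nonneg _) hn.2 n).1
      rw [← hsq n hn.1, one_div]
      congr 2
      ring)
    (by
      filter_upwards [hev] with n hn v hv
      refine (hb v hv (t n) (Real.sqrt_nonneg _) hn.2 n).2.trans_eq ?_
      rw [← hsq n hn.1]
      congr 2
      ring)
  rw [show 1 / 2 * quad μ C r y v₁ = quad μ C r y v₁ / 2 by ring]
  refine hlim.congr' ?_
  filter_upwards [hev] with n hn
  rw [← tsum_avgProb_mul_exp hC hφ₀, logGen]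
  congr 3
  ext k
  congr 2
  have hn0 : (0 : ℝ) < n := by exact_mod_cast Nat.pos_of_ne_zero hn.1
  have hcoef : a n / Real.sqrt (n * a n) = t n := by
    change _ = Real.sqrt (a n / n)
    rw [Real.sqrt_div (ha n).le, Real.sqrt_mul hn0.le]
    have h1 := Real.sqrt_pos.2 (ha n)
    have h2 := Real.sqrt_pos.2 hn0
    rw [div_eq_div_iff (by positivity) h2.ne']
    nth_rewrite 1 [← Real.mul_self_sqrt (ha n).le]
    ring
  rw [smul_dotProduct, ← hcoef, smul_eq_mul]
  simp only [dotProduct, rescaledPos, Finset.mul_sum]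
  exact Finset.sum_congr rfl fun i _ => by ring

end RandomQW

/-! ### Smooth dependence of the maximal value on the parameter. -/

namespace RandomQW

variable {d : ℕ}

/-- Near a nondegenerate critical point, the critical points of `v ↦ q (y, v)` lie on a smooth
branch. -/
lemma exists_critical_branch {q : (Fin d → ℝ) × (Fin d → ℝ) → ℝ}
    (hq : ContDiff ℝ ((⊤ : ℕ∞) : WithTop ℕ∞) q) (y₀ v₀ : Fin d → ℝ)
    (hcrit : fderiv ℝ (fun v => q (y₀, v)) v₀ = 0)
    (hdet : (hessian (fun v => q (y₀, v)) v₀).det ≠ 0) :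
    ∃ w : (Fin d → ℝ) → Fin d → ℝ, ContDiffAt ℝ ((⊤ : ℕ∞) : WithTop ℕ∞) w y₀ ∧
      ∀ᶠ p : (Fin d → ℝ) × (Fin d → ℝ) in 𝓝 (y₀, v₀),
        fderiv ℝ (fun v => q (p.1, v)) p.2 = 0 → p.2 = w p.1 := by
  let D : (Fin d → ℝ) × (Fin d → ℝ) → (Fin d → ℝ) →L[ℝ] ℝ :=
    fun p => fderiv ℝ (fun v => q (p.1, v)) p.2
  have hD : ContDiff ℝ ((⊤ : ℕ∞) : WithTop ℕ∞) D := by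
    refine ContDiff.fderiv (f := fun (p : (Fin d → ℝ) × (Fin d → ℝ)) v => q (p.1, v))
      (g := Prod.snd) (m := ((⊤ : ℕ∞) : WithTop ℕ∞)) ?_ contDiff_snd (by simp)
    exact hq.comp (by fun_prop)
  -- The inverse function theorem is applied to `(y, v) ↦ (y, ∂_v q)`. Its derivative is block
  -- triangular with the Hessian in the corner, hence invertible, and the branch is the second
  -- component of the inverse at `(y, 0)`.
  let F : (Fin d → ℝ) × (Fin d → ℝ) → (Fin d → ℝ) × (Fin d → ℝ) :=
    fun p => (p.1, fun j => D p (Pi.single j 1))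
  have hF : ContDiff ℝ ((⊤ : ℕ∞) : WithTop ℕ∞) F :=
    contDiff_fst.prodMk (contDiff_pi.2 fun j => hD.clm_apply contDiff_const)
  have hF' : HasFDerivAt F (fderiv ℝ F (y₀, v₀)) (y₀, v₀) :=
    (hF.differentiable (by simp) _).hasFDerivAt
  have hD' : HasFDerivAt D (fderiv ℝ D (y₀, v₀)) (y₀, v₀) :=
    (hD.differentiable (by simp) _).hasFDerivAt
  have hF'eq : fderiv ℝ F (y₀, v₀) = (ContinuousLinearMap.fst ℝ (Fin d → ℝ) (Fin d → ℝ)).prod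
      (ContinuousLinearMap.pi fun j =>
        (ContinuousLinearMap.apply ℝ ℝ (Pi.single j 1)).comp (fderiv ℝ D (y₀, v₀))) := by
    refine HasFDerivAt.fderiv (hasFDerivAt_fst.prodMk (hasFDerivAt_pi.2 fun j => ?_))
    exact (ContinuousLinearMap.apply ℝ ℝ (Pi.single j 1)).hasFDerivAt.comp _ hD'
  have hDv : ∀ k, fderiv ℝ D (y₀, v₀) (0, k) =
      fderiv ℝ (fderiv ℝ (fun v => q (y₀, v))) v₀ k := by
    intro k
    have h1 : HasFDerivAt (fun v : Fin d → ℝ => (y₀, v))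
        (ContinuousLinearMap.inr ℝ (Fin d → ℝ) (Fin d → ℝ)) v₀ := hasFDerivAt_prodMk_right y₀ v₀
    have h2 := hD'.comp v₀ h1
    have h3 : fderiv ℝ (fderiv ℝ (fun v => q (y₀, v))) v₀ =
      (fderiv ℝ D (y₀, v₀)).comp (ContinuousLinearMap.inr ℝ (Fin d → ℝ) (Fin d → ℝ)) := h2.fderiv
    rw [h3]
    rfl
  have hinj : Function.Injective (fderiv ℝ F (y₀, v₀)) := by
    rw [injective_iff_map_eq_zero]
    rintro ⟨h, k⟩ hk
    rw [hF'eq] at hk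
    have hk1 : h = 0 := congrArg Prod.fst hk
    subst hk1
    have hk2 := congrArg Prod.snd hk
    have : k ᵥ* hessian (fun v => q (y₀, v)) v₀ = 0 := by
      ext j
      have h4 : (fderiv ℝ D (y₀, v₀) (0, k)) (Pi.single j 1) = 0 := congrFun hk2 j
      rw [hDv] at h4
      rw [Pi.zero_apply, ← h4]
      conv_rhs => rw [pi_eq_sum_univ' k]
      rw [map_sum, _root_.sum_apply]
      simp only [vecMul, dotProduct, hessian, of_apply, iteratedFDeriv_two_apply, map_smul,
        _root_.smul_apply, smul_eq_mul]
      refine Finset.sum_congr rfl fun i _ => ?_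
      congr 3
    rw [eq_zero_of_vecMul_eq_zero hdet this]
    rfl
  let e : ((Fin d → ℝ) × (Fin d → ℝ)) ≃L[ℝ] ((Fin d → ℝ) × (Fin d → ℝ)) :=
    (LinearEquiv.ofInjectiveEndo (fderiv ℝ F (y₀, v₀) : _ →ₗ[ℝ] _) hinj).toContinuousLinearEquiv
  have he : HasFDerivAt F (e : _ →L[ℝ] _) (y₀, v₀) := by
    convert hF' using 1
    ext x <;> rfl
  have hn : ((⊤ : ℕ∞) : WithTop ℕ∞) ≠ 0 := by simp
  let g := (hF.contDiffAt (x := (y₀, v₀))).localInverse he hn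
  have hF0 : ∀ p, D p = 0 → F p = (p.1, 0) := by
    intro p hp
    simp only [F, hp]
    rfl
  refine ⟨fun y => (g (y, 0)).2, ?_, ?_⟩
  · have hg : ContDiffAt ℝ ((⊤ : ℕ∞) : WithTop ℕ∞) g (F (y₀, v₀)) :=
      (hF.contDiffAt (x := (y₀, v₀))).to_localInverse he hn
    rw [hF0 (y₀, v₀) hcrit] at hg
    exact contDiffAt_snd.comp y₀ (hg.comp y₀ (contDiffAt_id.prodMk contDiffAt_const))
  · have := ((hF.contDiffAt (x := (y₀, v₀))).hasStrictFDerivAt' he hn).eventually_left_inverse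
    filter_upwards [this] with p hp hDp
    have h5 : g (F p) = p := hp
    rw [hF0 p hDp] at h5
    exact (congrArg Prod.snd h5).symm

/-- If the number of maximum points is locally constant and all of them are nondegenerate, then
the maximal value depends smoothly on the parameter. -/
theorem contDiffOn_max_value {q : (Fin d → ℝ) × (Fin d → ℝ) → ℝ}
    (hq : ContDiff ℝ ((⊤ : ℕ∞) : WithTop ℕ∞) q)
    (hper : ∀ y v (k : Fin d → ℤ), q (y, v + fun i => 2 * Real.pi * k i) = q (y, v))
    {U : Set (Fin d → ℝ)} (hU : IsOpen U) {J : ℕ} {v₁ : (Fin d → ℝ) → Fin d → ℝ}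
    (h : ∀ y ∈ U, FiniteNondegMax (fun v => q (y, v)) ∧
      (maxPoints fun v => q (y, v)).ncard = J ∧ v₁ y ∈ maxPoints fun v => q (y, v)) :
    ContDiffOn ℝ ((⊤ : ℕ∞) : WithTop ℕ∞) (fun y => q (y, v₁ y)) U := by
  intro y₀ hy₀
  refine ContDiffAt.contDiffWithinAt ?_
  obtain ⟨⟨hfin, hnd⟩, hcard, hv₁⟩ := h y₀ hy₀
  have hcrit : ∀ y v, (∀ w, q (y, w) ≤ q (y, v)) → fderiv ℝ (fun v => q (y, v)) v = 0 :=
    fun y v hv => IsLocalMax.fderiv_eq_zero (Eventually.of_forall hv)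
  have hbr := fun v (hv : v ∈ maxPoints fun v => q (y₀, v)) =>
    exists_critical_branch hq y₀ v (hcrit y₀ v hv.2) (hnd v hv)
  choose! w hw hbr using hbr
  have hbr2 : ∀ v ∈ maxPoints (fun v => q (y₀, v)), ∃ N V : Set (Fin d → ℝ), IsOpen N ∧ y₀ ∈ N ∧
      IsOpen V ∧ v ∈ V ∧ ∀ y ∈ N, ∀ x ∈ V, fderiv ℝ (fun v => q (y, v)) x = 0 → x = w v y := by
    intro v hv
    obtain ⟨N, V, hN, hyN, hV, hvV, hsub⟩ := mem_nhds_prod_iff'.1 (hbr v hv)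
    exact ⟨N, V, hN, hyN, hV, hvV, fun y hy x hx hD => hsub (Set.mk_mem_prod hy hx) hD⟩
  choose! N V hN hyN hV hvV hNV using hbr2
  set m := maxPoints fun v => q (y₀, v)
  -- All lattice translates are included: when `y` moves, the representative of a maximum point in
  -- the cube can jump to the opposite face.
  set W : Set (Fin d → ℝ) :=
    ⋃ v ∈ m, ⋃ k : Fin d → ℤ, (fun x => x + fun i => 2 * Real.pi * k i) ⁻¹' V v
  have hW : IsOpen W := isOpen_biUnion fun v hv => isOpen_iUnion fun k =>
    (hV v hv).preimage (continuous_id.add continuous_const)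
  have hK : IsCompact (box d \ W) := by unfold box; exact isCompact_Icc.diff hW
  have hlt : ∀ x ∈ box d \ W, q (y₀, x) < q (y₀, v₁ y₀) := by
    rintro x ⟨-, hx⟩
    refine lt_of_le_of_ne (hv₁.2 x) fun heq => hx ?_
    obtain ⟨k, hk⟩ := exists_sub_period_mem x
    have hmem : (x + fun i => 2 * Real.pi * k i) ∈ m :=
      ⟨hk, fun w => by simp only [hper, heq]; exact hv₁.2 w⟩
    exact Set.mem_biUnion hmem (Set.mem_iUnion.2 ⟨k, hvV _ hmem⟩)
  -- By compactness the strict inequality off `W` persists, so no maximum points appear away from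
  -- the old ones.
  have hev1 : ∀ᶠ y in 𝓝 y₀, ∀ x ∈ box d \ W, q (y, x) < q (y, v₁ y₀) := by
    refine hK.eventually_forall_of_forall_eventually fun x hx => ?_
    have c1 : Continuous fun p : (Fin d → ℝ) × (Fin d → ℝ) => q (p.1, p.2) := hq.continuous
    have c2 : Continuous fun p : (Fin d → ℝ) × (Fin d → ℝ) => q (p.1, v₁ y₀) :=
      hq.continuous.comp (by fun_prop)
    exact c1.continuousAt.eventually_lt c2.continuousAt (hlt x hx)
  have hev2 : ∀ᶠ y in 𝓝 y₀, ∀ v ∈ m, y ∈ N v :=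
    (hfin.eventually_all).2 fun v hv => (hN v hv).mem_nhds (hyN v hv)
  have key : ∀ᶠ y in 𝓝 y₀, q (y, v₁ y) = q (y, w (v₁ y₀) y) := by
    filter_upwards [hev1, hev2, hU.mem_nhds hy₀] with y h1 h2 hyU
    obtain ⟨-, hcard', hv₁'⟩ := h y hyU
    have hex : ∀ x ∈ maxPoints (fun v => q (y, v)), ∃ v ∈ m, ∃ k : Fin d → ℤ,
        (x + fun i => 2 * Real.pi * k i) = w v y := by
      intro x hx
      have hxW : x ∈ W := by
        by_contra hxW
        exact (h1 x ⟨⟨fun i => (hx.1 i).1, fun i => (hx.1 i).2.le⟩, hxW⟩).not_ge (hx.2 _)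
      simp only [W, Set.mem_iUnion, Set.mem_preimage] at hxW
      obtain ⟨v, hv, k, hk⟩ := hxW
      exact ⟨v, hv, k, hNV v hv y (h2 v hv) _ hk
        (hcrit y _ fun z => by rw [hper]; exact hx.2 z)⟩
    choose! f hf k hk using hex
    -- Assigning to a maximum point for `y` the old point whose branch carries it is injective. Both
    -- sets have `J` elements, so it is onto, and in particular the branch through `v₁ y₀` still
    -- consists of maximum points.
    obtain ⟨x, hx, hxe⟩ := Set.surj_on_of_inj_on_of_ncard_le (s := maxPoints fun v => q (y, v))
      (t := m) (fun x _ => f x) hf (fun x x' hx hx' hxx' => by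
        refine eq_of_add_period_eq hx.1 hx'.1 (k x) (k x') ?_
        rw [hk x hx, hk x' hx', hxx']) (by rw [hcard, hcard']) hfin (v₁ y₀) hv₁
    rw [hxe, ← hk x hx, hper]
    exact le_antisymm (hx.2 _) (hv₁'.2 _)
  refine ContDiffAt.congr_of_eventuallyEq ?_ key
  exact hq.contDiffAt.comp y₀ (contDiffAt_id.prodMk (hw _ hv₁))

end RandomQW

/-! ### Homogeneity, convexity and behaviour at the origin. -/

namespace RandomQW

/-- A function which is homogeneous of degree two and `C¹` away from the origin is `C¹`. -/
lemma contDiff_one_of_homogeneous {E : Type*} [NormedAddCommGroup E] [NormedSpace ℝ E]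
    [FiniteDimensional ℝ E] {L : E → ℝ} (hL : ContDiffOn ℝ 1 L {0}ᶜ)
    (hom : ∀ (c : ℝ) y, L (c • y) = c ^ 2 * L y) : ContDiff ℝ 1 L := by
  have hopen : IsOpen ({0}ᶜ : Set E) := isOpen_compl_singleton
  have hL0 : L 0 = 0 := by simpa using hom 0 0
  have hdiff : ∀ y : E, y ≠ 0 → DifferentiableAt ℝ L y := fun y hy =>
    (hL.contDiffAt (hopen.mem_nhds hy)).differentiableAt (by simp)
  have hcont : ContinuousOn (fderiv ℝ L) {0}ᶜ := hL.continuousOn_fderiv_of_isOpen hopen le_rfl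
  have hsph : ∀ y ∈ Metric.sphere (0 : E) 1, y ≠ 0 := fun y hy h => by simp [h] at hy
  obtain ⟨M, hM⟩ := (isCompact_sphere (0 : E) 1).exists_bound_of_continuousOn
    (hcont.mono fun y hy => hsph y hy)
  obtain ⟨M', hM'⟩ := (isCompact_sphere (0 : E) 1).exists_bound_of_continuousOn
    (hL.continuousOn.mono fun y hy => hsph y hy)
  have hnorm : ∀ y : E, y ≠ 0 → ‖y‖⁻¹ • y ∈ Metric.sphere (0 : E) 1 := fun y hy => by
    simp [norm_smul, norm_ne_zero_iff.2 hy]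
  have hback : ∀ y : E, y ≠ 0 → ‖y‖ • (‖y‖⁻¹ • y) = y := fun y hy => by
    rw [smul_smul, mul_inv_cancel₀ (norm_ne_zero_iff.2 hy), one_smul]
  -- The derivative is homogeneous of degree one, so its bound on the unit sphere forces it to tend
  -- to `0` at the origin.
  have hfd : ∀ (c : ℝ) (y : E), c ≠ 0 → y ≠ 0 → fderiv ℝ L (c • y) = c • fderiv ℝ L y := by
    intro c y hc hy
    have h1 : HasFDerivAt (fun y => L (c • y))
        ((fderiv ℝ L (c • y)).comp (c • ContinuousLinearMap.id ℝ E)) y :=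
      (hdiff _ (smul_ne_zero hc hy)).hasFDerivAt.comp y ((hasFDerivAt_id y).const_smul c)
    have h2 : HasFDerivAt (fun y => L (c • y)) (c ^ 2 • fderiv ℝ L y) y := by
      simp only [hom]
      exact (hdiff y hy).hasFDerivAt.const_mul (c ^ 2)
    have h3 := h1.unique h2
    ext z
    have h4 := congrArg (fun A : E →L[ℝ] ℝ => A z) h3
    simp only [ContinuousLinearMap.comp_apply, _root_.smul_apply,
      ContinuousLinearMap.id_apply, map_smul, smul_eq_mul] at h4 ⊢
    have : c * (fderiv ℝ L (c • y)) z = c * (c * (fderiv ℝ L y) z) := by rw [h4]; ring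
    exact mul_left_cancel₀ hc this
  have hfdbound : ∀ y : E, y ≠ 0 → ‖fderiv ℝ L y‖ ≤ M * ‖y‖ := by
    intro y hy
    rw [← hback y hy, hfd _ _ (norm_ne_zero_iff.2 hy) (hsph _ (hnorm y hy)), norm_smul, norm_norm,
      hback y hy, mul_comm]
    gcongr
    exact hM _ (hnorm y hy)
  have hbound : ∀ y : E, |L y| ≤ |M'| * ‖y‖ ^ 2 := by
    intro y
    by_cases hy : y = 0
    · simp [hy, hL0]
    · have h1 := hM' _ (hnorm y hy)
      rw [Real.norm_eq_abs] at h1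
      have h2 : L y = ‖y‖ ^ 2 * L (‖y‖⁻¹ • y) := by rw [← hom, hback y hy]
      rw [h2, abs_mul, abs_of_nonneg (sq_nonneg ‖y‖), mul_comm]
      exact mul_le_mul_of_nonneg_right (h1.trans (le_abs_self _)) (sq_nonneg _)
  have h0 : HasFDerivAt L (0 : E →L[ℝ] ℝ) 0 := by
    rw [hasFDerivAt_iff_isLittleO_nhds_zero]
    simp only [zero_add, hL0, sub_zero, _root_.zero_apply]
    refine (Asymptotics.IsBigO.of_bound |M'| (Eventually.of_forall fun y => ?_)).trans_isLittleO
      (Asymptotics.isLittleO_pow_id (𝕜 := ℝ) (n := 2) (by norm_num) |>.comp_tendsto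
        (tendsto_norm_zero (E := E)) |>.trans_isBigO
          (Asymptotics.IsBigO.of_bound 1 (Eventually.of_forall fun y => by simp)))
    rw [Real.norm_eq_abs]
    simpa using hbound y
  rw [contDiff_one_iff_fderiv]
  refine ⟨fun y => ?_, continuous_iff_continuousAt.2 fun y => ?_⟩
  · by_cases hy : y = 0
    · exact hy ▸ h0.differentiableAt
    · exact hdiff y hy
  · by_cases hy : y = 0
    · subst hy
      rw [ContinuousAt, h0.fderiv, tendsto_zero_iff_norm_tendsto_zero]
      have hlim : Tendsto (fun y : E => |M| * ‖y‖) (𝓝 0) (𝓝 0) := by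
        simpa using (tendsto_norm_zero (E := E)).const_mul |M|
      refine squeeze_zero (fun _ => norm_nonneg _) (fun y => ?_) hlim
      by_cases hy : y = 0
      · simp [hy, h0.fderiv]
      · exact (hfdbound y hy).trans (by gcongr; exact le_abs_self M)
    · exact hcont.continuousAt (hopen.mem_nhds hy)

variable {d : ℕ} {Ω : Type*} [MeasurableSpace Ω] {μ : Measure Ω} {C : Ω → Coin d}
  {r : CoinIdx d → Fin d → ℤ}

/-- At `y = 0` the form vanishes identically, so the arbitrary value `v₁ 0` is harmless. -/
lemma quad_le_of_mem_maxPoints {v₁ : (Fin d → ℝ) → Fin d → ℝ}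
    (h : ∀ y, y ≠ 0 → v₁ y ∈ maxPoints (quad μ C r y)) (y v : Fin d → ℝ) :
    quad μ C r y v ≤ quad μ C r y (v₁ y) := by
  by_cases hy : y = 0
  · simp [hy, quad_zero]
  · exact (h y hy).2 v

/-- The chosen points `v₁ y` and `v₁ (c • y)` may differ; only the maximal values are compared. -/
lemma max_quad_smul {v₁ : (Fin d → ℝ) → Fin d → ℝ}
    (h : ∀ y, y ≠ 0 → v₁ y ∈ maxPoints (quad μ C r y)) (c : ℝ) (y : Fin d → ℝ) :
    quad μ C r (c • y) (v₁ (c • y)) = c ^ 2 * quad μ C r y (v₁ y) := by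
  have hle := quad_le_of_mem_maxPoints h
  refine le_antisymm ?_ ?_
  · rw [quad_smul]
    exact mul_le_mul_of_nonneg_left (hle _ _) (sq_nonneg c)
  · rw [← quad_smul]
    exact hle _ _

lemma quad_convex {v : Fin d → ℝ} (hD : (diffusion μ C r v).PosDef) (y z : Fin d → ℝ) {a b : ℝ}
    (ha : 0 ≤ a) (hb : 0 ≤ b) (hab : a + b = 1) :
    quad μ C r (a • y + b • z) v ≤ a * quad μ C r y v + b * quad μ C r z v := by
  have hpos : 0 ≤ quad μ C r (y - z) v := by
    simpa [quad] using hD.posSemidef.dotProduct_mulVec_nonneg (y - z)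
  have hid : a * quad μ C r y v + b * quad μ C r z v - quad μ C r (a • y + b • z) v =
      a * b * quad μ C r (y - z) v := by
    simp only [quad, mulVec_add, mulVec_sub, mulVec_smul, dotProduct_add, dotProduct_sub,
      dotProduct_smul, add_dotProduct, sub_dotProduct, smul_dotProduct, smul_eq_mul]
    obtain rfl : b = 1 - a := by linarith
    ring
  nlinarith [mul_nonneg (mul_nonneg ha hb) hpos]

/-- A maximum of convex functions is convex: the form at the maximum point of the combination is
convex and lies below the maximum at both endpoints. -/
lemma convexOn_max_quad (hD : ∀ v, (diffusion μ C r v).PosDef) {v₁ : (Fin d → ℝ) → Fin d → ℝ}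
    (h : ∀ y, y ≠ 0 → v₁ y ∈ maxPoints (quad μ C r y)) :
    ConvexOn ℝ Set.univ fun y => 1 / 2 * quad μ C r y (v₁ y) := by
  refine ⟨convex_univ, fun y _ z _ a b ha hb hab => ?_⟩
  have hle := quad_le_of_mem_maxPoints h
  have h1 := quad_convex (hD (v₁ (a • y + b • z))) y z ha hb hab
  have h2 := mul_le_mul_of_nonneg_left (hle y (v₁ (a • y + b • z))) ha
  have h3 := mul_le_mul_of_nonneg_left (hle z (v₁ (a • y + b • z))) hb
  simp only [smul_eq_mul]
  linarith

end RandomQW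

theorem mainTheorem4 {d : ℕ} {Ω : Type*} [MeasurableSpace Ω] (μ : Measure Ω)
    [IsProbabilityMeasure μ] (C : Ω → RandomQW.Coin d)
    (hC : ∀ τ σ, Measurable fun ω => (C ω : Matrix (RandomQW.CoinIdx d) (RandomQW.CoinIdx d) ℂ) τ σ)
    (r : RandomQW.CoinIdx d → Fin d → ℤ)
    (φ₀ : RandomQW.CoinIdx d → ℂ) (hφ₀ : ∑ τ, ‖φ₀ τ‖ ^ 2 = 1)
    (hS : RandomQW.AssumptionS μ C r)
    (hD : ∀ v, (RandomQW.diffusion μ C r v).PosDef)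
    (a : ℕ → ℝ) (ha : ∀ n, 0 < a n) (ha_top : Tendsto a atTop atTop)
    (ha_zero : Tendsto (fun n : ℕ => a n / n) atTop (𝓝 0)) :
    -- maximum points exist
    (∀ y : Fin d → ℝ, (RandomQW.maxPoints (RandomQW.quad μ C r y)).Nonempty) ∧
    -- the limit, for each `y` separately
    (∀ y : Fin d → ℝ, RandomQW.ConstOrNondegMax (RandomQW.quad μ C r y) →
      ∀ v₁ ∈ RandomQW.maxPoints (RandomQW.quad μ C r y),
        Tendsto (fun n : ℕ => 1 / a n * RandomQW.logGen μ C r φ₀ a n (a n • y)) atTop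
          (𝓝 (1 / 2 * RandomQW.quad μ C r y v₁))) ∧
    -- properties of the limit as a function of `y`
    (∀ v₁ : (Fin d → ℝ) → Fin d → ℝ,
      -- convexity
      ((∀ y, y ≠ 0 → RandomQW.ConstOrNondegMax (RandomQW.quad μ C r y) ∧
          v₁ y ∈ RandomQW.maxPoints (RandomQW.quad μ C r y)) →
        ConvexOn ℝ Set.univ fun y => 1 / 2 * RandomQW.quad μ C r y (v₁ y)) ∧
      -- smoothness where the number of maximum points is constant
      (∀ (U : Set (Fin d → ℝ)) (J : ℕ), IsOpen U →
        (∀ y ∈ U, RandomQW.FiniteNondegMax (RandomQW.quad μ C r y) ∧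
          (RandomQW.maxPoints (RandomQW.quad μ C r y)).ncard = J ∧
          v₁ y ∈ RandomQW.maxPoints (RandomQW.quad μ C r y)) →
        ContDiffOn ℝ ((⊤ : ℕ∞) : WithTop ℕ∞) (fun y => 1 / 2 * RandomQW.quad μ C r y (v₁ y)) U) ∧
      -- regularity at the origin
      (∀ J : ℕ, (∀ y, y ≠ 0 → RandomQW.FiniteNondegMax (RandomQW.quad μ C r y) ∧
          (RandomQW.maxPoints (RandomQW.quad μ C r y)).ncard = J ∧
          v₁ y ∈ RandomQW.maxPoints (RandomQW.quad μ C r y)) →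
        ContDiff ℝ 1 fun y => 1 / 2 * RandomQW.quad μ C r y (v₁ y)) ∧
      -- smoothness on the whole space
      ((∀ y, y ≠ 0 → v₁ y ∈ RandomQW.maxPoints (RandomQW.quad μ C r y)) →
        (d = 1 ∨ ∀ v w, RandomQW.diffusion μ C r v = RandomQW.diffusion μ C r w) →
        ContDiff ℝ ((⊤ : ℕ∞) : WithTop ℕ∞) fun y => 1 / 2 * RandomQW.quad μ C r y (v₁ y))) := by
  -- For `d = 0` the coin space is zero and contains no unit vector.
  have hd : d ≠ 0 := by
    rintro rfl
    simp at hφ₀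
  have hq : ContDiff ℝ ((⊤ : ℕ∞) : WithTop ℕ∞) fun p : (Fin d → ℝ) × (Fin d → ℝ) =>
      RandomQW.quad μ C r p.1 p.2 := RandomQW.contDiff_quad hd hC hS
  have hper := RandomQW.quad_add_period (μ := μ) (C := C) (r := r)
  refine ⟨fun y => RandomQW.maxPoints_nonempty (hq.continuous.comp (f := fun v => (y, v))
      (by fun_prop)) (hper y), fun y _ v₁ hv₁ =>
    RandomQW.tendsto_logGen hd hC hφ₀ hS ha ha_top ha_zero y v₁ hv₁, fun v₁ => ⟨fun h =>
      RandomQW.convexOn_max_quad hD fun y hy => (h y hy).2, fun U J hU h => ?_, fun J h => ?_,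
      fun h hd1 => ?_⟩⟩
  · exact contDiffOn_const.mul (RandomQW.contDiffOn_max_value hq hper hU h)
  · have h' : ∀ y, y ≠ 0 → v₁ y ∈ RandomQW.maxPoints (RandomQW.quad μ C r y) :=
      fun y hy => (h y hy).2.2
    refine contDiff_const.mul (RandomQW.contDiff_one_of_homogeneous
      ((RandomQW.contDiffOn_max_value hq hper isOpen_compl_singleton
        fun y hy => h y hy).of_le (by exact_mod_cast le_top)) fun c y => ?_)
    exact RandomQW.max_quad_smul h' c y
  · refine contDiff_const.mul ?_
    rcases hd1 with rfl | hconst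
    -- On a line, homogeneity of degree two determines the function from its value at `1`.
    · have e : ∀ y : Fin 1 → ℝ, RandomQW.quad μ C r y (v₁ y) =
          y 0 ^ 2 * RandomQW.quad μ C r 1 (v₁ 1) := by
        intro y
        rw [← RandomQW.max_quad_smul h]
        have : y 0 • (1 : Fin 1 → ℝ) = y := by
          ext i
          fin_cases i
          simp
        rw [this]
      rw [show (fun y => RandomQW.quad μ C r y (v₁ y)) =
        fun y : Fin 1 → ℝ => y 0 ^ 2 * RandomQW.quad μ C r 1 (v₁ 1) from funext e]
      fun_prop
    · have e : ∀ y : Fin d → ℝ, RandomQW.quad μ C r y (v₁ y) = RandomQW.quad μ C r y 0 := by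
        intro y
        simp only [RandomQW.quad, hconst (v₁ y) 0]
      simp only [e]
      exact hq.comp (f := fun y => (y, (0 : Fin d → ℝ))) (by fun_prop)
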